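/- Let $I$ and $K$ be real symmetric $3\times 3$ matrices (the inertia tensors of a rigid body and of three rotors), let $G=Q=SO(3)\times \mathbb{S}^1\times\mathbb{S}^1\times\mathbb{S}^1$ with its product Lie group structure, and let $\mathfrak{so}(3)$ be identified with $(\mathbb{R}^3,\times)$. For $(R,\theta,\dot R,\dot\theta)\in TQ$ put $\Omega=R^{-1}\dot R\in\mathfrak{so}(3)\cong\mathbb{R}^3$ and $\Omega_r=\dot\theta\in\mathbb{R}^3$. The Lagrangian of the free rigid body with three rotors is $$L(R,\theta,\dot R,\dot\theta)=\tfrac12\langle R^{-1}\dot R, I R^{-1}\dot R\rangle+\tfrac12\langle R^{-1}\dot R+\dot\theta,K(R^{-1}\dot R+\dot\theta)\rangle .$$ (1) The action of $G$ on $TQ$ lifted from left translations is free and proper, $L$ is $G$-invariant, and $[R,\theta,\dot R,\dot\theta]\mapsto(\Omega,\Omega_r)$ is a well-defined homeomorphism $TQ/G\to\mathfrak{so}(3)\oplus\mathbb{R}^3$, through which $L$ descends to the reduced Lagrangian $$\ell(\Omega,\Omega_r)=\tfrac12\langle\Omega,I\Omega\rangle+\tfrac12\langle\Omega+\Omega_r,K(\Omega+\Omega_r)\rangle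 .$$ (2) Let $t_0<t_1$ and let $v=(\Omega,\Omega_r):[t_0,t_1]\to\mathfrak{so}(3)\oplus\mathbb{R}^3$ be any smooth curve. The following are equivalent: (a) $\frac{d}{d\varepsilon}\big|_{\varepsilon=0}\int_{t_0}^{t_1}\ell(v_\varepsilon(t))\,dt=0$ for all smooth variations $v_\varepsilon$ of $v$ with $\delta v=\dot w+[v,w]$ for a smooth curve $w$ in $\mathfrak{so}(3)\oplus\mathbb{R}^3$ with $w(t_0)=w(t_1)=0$, where $[(\alpha_1,\beta_1),(\alpha_2,\beta_2)]=(\alpha_1\times\alpha_2,0)$; (b) the Euler–Poincaré equations $\frac{d}{dt}\frac{\partial\ell}{\partial v}=\mathrm{ad}^*_{v}\frac{\partial\ell}{\partial v}$ hold on $[t_0,t_1]$, where $(\mathrm{ad}^*_v\mu)(u)=\mu([v,u])$; (c) on $[t_0,t_1]$, $$(I+K)\dot\Omega+K\dot\Omega_r=((I+K)\Omega+K\Omega_r)\times\Omega,\qquad K\dot\Omega_r+K\dot\Omega=0 .$$ (3) Let $q=(R,\theta):[t_0,t_1]\to Q$ be any smooth curve. Its reduced curve $(\Omega,\Omega_r)=(R^{-1}\dot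 R,\dot\theta)$ is smooth, and $q$ is critical for $\int_{t_0}^{t_1}L(q,\dot q)\,dt$ among smooth variations with fixed endpoints if and only if its reduced curve satisfies (a), equivalently (c). (4) Let $J(q,\dot q)\in(\mathbb{R}^3)^*$, $J(q,\dot q)(a)=\langle\frac{\partial L}{\partial\dot q},a_Q\rangle$, be the momentum of the rotors, i.e. the Noether current of the action of $\mathbb{S}^1\times\mathbb{S}^1\times\mathbb{S}^1$ by translations of the rotor angles ($a_Q$ being the infinitesimal generator of $a$). Then $J(q,\dot q)(a)=\langle K(\Omega+\Omega_r),a\rangle$ on $TQ$, and for every smooth curve $q:[t_0,t_1]\to Q$ the second equation in (c) holds for its reduced curve if and only if $J(q,\dot q)$ is constant on $[t_0,t_1]$. -/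

import Mathlib

open scoped Matrix ContDiff

namespace RotorBody

/-- Vectors of `ℝ³`; the scalar product is `⬝ᵥ` and the vector product `⨯₃`. -/
abbrev R3 : Type := Fin 3 → ℝ

/-- Real `3 × 3` matrices. -/
abbrev Mat3 : Type := Matrix (Fin 3) (Fin 3) ℝ

/-- The rotation group. -/
abbrev SO3 : Type := Matrix.specialOrthogonalGroup (Fin 3) ℝ

/-- The torus `S¹ × S¹ × S¹`; the rotor angle `θ k` is encoded by `z k = exp (i θ k)`. -/
abbrev T3 : Type := Fin 3 → Circle

/-- The configuration space `SO(3) × S¹ × S¹ × S¹`, which is also the symmetry group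
(with the product group structure). -/
abbrev Q : Type := SO3 × T3

/-- The vector space of pairs (matrix, triple of complex numbers), in which the configuration
space is an embedded submanifold. -/
abbrev Amb : Type := (Fin 3 → Fin 3 → ℝ) × (Fin 3 → ℂ)

/-- The embedding of the configuration space in the vector space `Amb`. -/
def emb (q : Q) : Amb := (fun i j => (q.1 : Mat3) i j, fun k => (q.2 k : ℂ))

/-- The body frame velocity `R⁻¹ Ṙ` of the rigid body, as a matrix. -/
def bodyMatrix (R : SO3) (dR : Fin 3 → Fin 3 → ℝ) : Mat3 :=
  ((R⁻¹ : SO3) : Mat3) * Matrix.of dR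

/-- `w = (Ṙ, ż)` is tangent to the configuration space at `q = (R, z)`: the matrix `R⁻¹ Ṙ` lies in
`so(3)`, i.e. is skew-symmetric, and each `z⁻¹ ż` lies in `i ℝ`. -/
def IsTangent (q : Q) (w : Amb) : Prop :=
  (bodyMatrix q.1 w.1)ᵀ = -bodyMatrix q.1 w.1 ∧
    ∀ k, (((q.2 k)⁻¹ : Circle) * w.2 k : ℂ).re = 0

/-- The tangent bundle of the configuration space. Its points are `((R, z), (Ṙ, ż))`. -/
abbrev TQ : Type := {x : Q × Amb // IsTangent x.1 x.2}

/-- The isomorphism `ℝ³ → so(3)`, under which the vector product becomes the commutator. -/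
def hat (v : R3) : Mat3 :=
  !![0, -v 2, v 1; v 2, 0, -v 0; -v 1, v 0, 0]

/-- The inverse of `hat`, on skew-symmetric matrices. -/
def vee (A : Mat3) : R3 := ![A 2 1, A 0 2, A 1 0]

theorem vee_hat (v : R3) : vee (hat v) = v := by
  ext k; fin_cases k <;> simp [vee, hat]

theorem hat_vee (A : Mat3) (hA : Aᵀ = -A) : hat (vee A) = A := by
  have h : ∀ i j, A j i = -A i j := fun i j => congrFun (congrFun hA i) j
  ext i j
  fin_cases i <;> fin_cases j <;> simp [vee, hat] <;>
    first
      | linarith [h 0 0] | linarith [h 1 1] | linarith [h 2 2]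
      | linarith [h 0 1] | linarith [h 0 2] | linarith [h 1 2]

theorem hat_mulVec (v u : R3) : hat v *ᵥ u = v ⨯₃ u := by
  ext k
  fin_cases k <;> simp [hat, Matrix.mulVec, dotProduct, Fin.sum_univ_three, cross_apply] <;> ring

theorem hat_cross (a b : R3) : hat (a ⨯₃ b) = hat a * hat b - hat b * hat a := by
  ext i j
  fin_cases i <;> fin_cases j <;>
    simp [hat, cross_apply] <;> ring

/-- The angular velocity `Ω = R⁻¹ Ṙ` of the rigid body, as a vector of `ℝ³ ≅ so(3)`. -/
def bodyVel (x : TQ) : R3 := vee (bodyMatrix x.1.1.1 x.1.2.1)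

/-- The angular velocity `Ω_r = θ̇` of the rotors: `ż k = i (θ̇ k) (z k)`. -/
noncomputable def rotorVel (x : TQ) : R3 :=
  fun k => (((x.1.1.2 k)⁻¹ : Circle) * x.1.2.2 k : ℂ).im

/-- The Lagrangian of the free rigid body with rotors; `I` is the inertia tensor of the rigid body
and `K` that of the rotors. -/
noncomputable def lagrangian (I K : Mat3) (x : TQ) : ℝ :=
  1 / 2 * (bodyVel x ⬝ᵥ (I *ᵥ bodyVel x)) +
    1 / 2 * ((bodyVel x + rotorVel x) ⬝ᵥ (K *ᵥ (bodyVel x + rotorVel x)))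

/-! ### The tangent lift of the action of the group on itself by left translations -/

theorem isTangent_smul (g q : Q) (w : Amb) (h : IsTangent q w) :
    IsTangent (g * q) ((g.1 : Mat3) * Matrix.of w.1, fun k => (g.2 k : ℂ) * w.2 k) := by
  have key : bodyMatrix (g * q).1 ((g.1 : Mat3) * Matrix.of w.1) = bodyMatrix q.1 w.1 := by
    have h1 : ((g.1⁻¹ : SO3) : Mat3) * (g.1 : Mat3) = 1 := by
      rw [← Submonoid.coe_mul, inv_mul_cancel, Submonoid.coe_one]
    unfold bodyMatrix
    rw [Prod.fst_mul, mul_inv_rev, Submonoid.coe_mul]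
    change ((q.1⁻¹ : SO3) : Mat3) * ((g.1⁻¹ : SO3) : Mat3) * ((g.1 : Mat3) * Matrix.of w.1) = _
    rw [Matrix.mul_assoc, ← Matrix.mul_assoc _ (g.1 : Mat3), h1, Matrix.one_mul]
  refine ⟨?_, fun k => ?_⟩
  · change (bodyMatrix (g * q).1 ((g.1 : Mat3) * Matrix.of w.1))ᵀ = -bodyMatrix (g * q).1 _
    rw [key]; exact h.1
  · have h2 := h.2 k
    have : (((g * q).2 k)⁻¹ : Circle) * ((g.2 k : ℂ) * w.2 k)
        = (((q.2 k)⁻¹ : Circle) * w.2 k : ℂ) := by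
      have hg : (g.2 k : ℂ) ≠ 0 := Circle.coe_ne_zero _
      simp only [Prod.snd_mul, Pi.mul_apply, mul_inv_rev, Circle.coe_mul, Circle.coe_inv]
      field_simp
    change ((((g * q).2 k)⁻¹ : Circle) * ((g.2 k : ℂ) * w.2 k) : ℂ).re = 0
    rw [this]; exact h2

/-- The tangent map of the left translation by `g = (S, φ)`:
`(R, z, Ṙ, ż) ↦ (S R, φ z, S Ṙ, φ ż)`. -/
noncomputable def leftLift (g : Q) (x : TQ) : TQ :=
  ⟨(g * x.1.1, ((g.1 : Mat3) * Matrix.of x.1.2.1, fun k => (g.2 k : ℂ) * x.1.2.2 k)),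
    isTangent_smul g x.1.1 x.1.2 x.2⟩

/-- The action of the group on the tangent bundle lifted from left translations. -/
noncomputable instance instMulActionTQ : MulAction Q TQ where
  smul := leftLift
  one_smul x := by
    apply Subtype.ext
    change (1 * x.1.1, (((1 : SO3) : Mat3) * Matrix.of x.1.2.1,
      fun k => (((1 : T3) k : Circle) : ℂ) * x.1.2.2 k)) = x.1
    refine Prod.ext (one_mul _) (Prod.ext ?_ ?_)
    · change ((1 : SO3) : Mat3) * Matrix.of x.1.2.1 = _
      rw [Submonoid.coe_one, Matrix.one_mul]; rfl
    · funext k; simp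
  mul_smul g h x := by
    apply Subtype.ext
    refine Prod.ext (mul_assoc _ _ _) (Prod.ext ?_ ?_)
    · change ((g.1 * h.1 : SO3) : Mat3) * Matrix.of x.1.2.1
        = (g.1 : Mat3) * ((h.1 : Mat3) * Matrix.of x.1.2.1)
      rw [Submonoid.coe_mul, Matrix.mul_assoc]
    · funext k
      change (((g.2 k * h.2 k : Circle)) : ℂ) * x.1.2.2 k = (g.2 k : ℂ) * ((h.2 k : ℂ) * x.1.2.2 k)
      rw [Circle.coe_mul, mul_assoc]

/-! ### Hamilton's principle on the configuration space -/

/-- Smoothness on a set of a map with values in the embedded submanifold `Q`. -/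
def SmoothMapOn {E : Type*} [NormedAddCommGroup E] [NormedSpace ℝ E] (f : E → Q) (S : Set E) :
    Prop :=
  ContDiffOn ℝ ∞ (fun e => emb (f e)) S

theorem isTangent_zero (q : Q) : IsTangent q 0 := by
  have h : bodyMatrix q.1 (0 : Amb).1 = 0 := Matrix.mul_zero _
  exact ⟨by rw [h]; simp, fun k => by simp⟩

theorem coe_inv_SO3 (R : SO3) : ((R⁻¹ : SO3) : Mat3) = (R : Mat3)ᵀ := rfl

theorem isTangent_of_hasDerivWithinAt (q : ℝ → Q) (S : Set ℝ) (t : ℝ) (w : Amb)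
    (hu : UniqueDiffWithinAt ℝ S t) (h : HasDerivWithinAt (fun s => emb (q s)) w S t) :
    IsTangent (q t) w := by
  have hR : ∀ i j, HasDerivWithinAt (fun s => ((q s).1 : Mat3) i j) (w.1 i j) S t := fun i j =>
    (hasDerivWithinAt_pi.1 ((hasDerivWithinAt_pi.1 h.fst) i)) j
  have hz : ∀ k, HasDerivWithinAt (fun s => ((q s).2 k : ℂ)) (w.2 k) S t := fun k =>
    (hasDerivWithinAt_pi.1 h.snd) k
  constructor
  · have key : ∀ i j, ∑ k, (w.1 k i * ((q t).1 : Mat3) k j + ((q t).1 : Mat3) k i * w.1 k j) = 0 := by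
      intro i j
      have h1 : HasDerivWithinAt (fun s => ∑ k, ((q s).1 : Mat3) k i * ((q s).1 : Mat3) k j)
          (∑ k, (w.1 k i * ((q t).1 : Mat3) k j + ((q t).1 : Mat3) k i * w.1 k j)) S t :=
        HasDerivWithinAt.fun_sum fun k _ => (hR k i).mul (hR k j)
      have h2 : (fun s => ∑ k, ((q s).1 : Mat3) k i * ((q s).1 : Mat3) k j)
          = fun _ => (1 : Mat3) i j := by
        funext s
        have h3 : ((q s).1 : Mat3)ᵀ * ((q s).1 : Mat3) = 1 := by
          rw [← coe_inv_SO3, ← Submonoid.coe_mul, inv_mul_cancel, Submonoid.coe_one]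
        rw [← h3, Matrix.mul_apply]; rfl
      rw [h2] at h1
      exact hu.eq_deriv _ h1 (hasDerivWithinAt_const _ _ _)
    ext i j
    have h4 := key i j
    rw [Finset.sum_add_distrib] at h4
    have h5 : bodyMatrix (q t).1 w.1 j i = ∑ k, w.1 k i * ((q t).1 : Mat3) k j := by
      unfold bodyMatrix
      rw [coe_inv_SO3, Matrix.mul_apply]
      exact Finset.sum_congr rfl fun k _ => mul_comm _ _
    have h6 : bodyMatrix (q t).1 w.1 i j = ∑ k, ((q t).1 : Mat3) k i * w.1 k j := by
      unfold bodyMatrix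
      rw [coe_inv_SO3, Matrix.mul_apply]
      rfl
    rw [Matrix.transpose_apply, Matrix.neg_apply, h5, h6]
    linarith
  · intro k
    have hre : HasDerivWithinAt (fun s => ((q s).2 k : ℂ).re) (w.2 k).re S t :=
      (Complex.reCLM.hasFDerivAt.comp_hasDerivWithinAt t (hz k))
    have him : HasDerivWithinAt (fun s => ((q s).2 k : ℂ).im) (w.2 k).im S t :=
      (Complex.imCLM.hasFDerivAt.comp_hasDerivWithinAt t (hz k))
    have h1 := (hre.mul hre).add (him.mul him)
    have h2 : ((fun s => ((q s).2 k : ℂ).re) * (fun s => ((q s).2 k : ℂ).re) +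
        (fun s => ((q s).2 k : ℂ).im) * (fun s => ((q s).2 k : ℂ).im)) = fun _ => (1 : ℝ) := by
      funext s
      have := Circle.normSq_coe ((q s).2 k)
      rw [Complex.normSq_apply] at this
      exact this
    rw [h2] at h1
    have h3 := hu.eq_deriv _ h1 (hasDerivWithinAt_const _ _ _)
    rw [Circle.coe_inv_eq_conj, Complex.mul_re, Complex.conj_re, Complex.conj_im]
    linarith

theorem isTangent_derivWithin (q : ℝ → Q) (S : Set ℝ) (t : ℝ) :
    IsTangent (q t) (derivWithin (fun s => emb (q s)) S t) := by
  by_cases hu : UniqueDiffWithinAt ℝ S t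
  · by_cases h : DifferentiableWithinAt ℝ (fun s => emb (q s)) S t
    · exact isTangent_of_hasDerivWithinAt q S t _ hu h.hasDerivWithinAt
    · rw [derivWithin_zero_of_not_differentiableWithinAt h]
      exact isTangent_zero _
  · rw [derivWithin_zero_of_not_uniqueDiffWithinAt hu]
    exact isTangent_zero _

/-- The curve `t ↦ (q t, q̇ t)` in the tangent bundle; the velocity is taken within the time
interval `S` (one-sided at its endpoints). -/
noncomputable def tangentLift (q : ℝ → Q) (S : Set ℝ) (t : ℝ) : TQ :=
  ⟨(q t, derivWithin (fun s => emb (q s)) S t), isTangent_derivWithin q S t⟩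

/-- The action on the tangent bundle is indeed the tangent lift of the action on `Q`. -/
theorem tangentLift_mul (g : Q) (q : ℝ → Q) (S : Set ℝ) (t : ℝ)
    (h : DifferentiableWithinAt ℝ (fun s => emb (q s)) S t) (hu : UniqueDiffWithinAt ℝ S t) :
    tangentLift (fun s => g * q s) S t = g • tangentLift q S t := by
  apply Subtype.ext
  refine Prod.ext rfl ?_
  change derivWithin (fun s => emb (g * q s)) S t = _
  refine HasDerivWithinAt.derivWithin ?_ hu
  have hw := h.hasDerivWithinAt
  have hR := hasDerivWithinAt_pi.1 hw.fst
  have hz := hasDerivWithinAt_pi.1 hw.snd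
  refine HasDerivWithinAt.prodMk ?_ ?_
  · refine hasDerivWithinAt_pi.2 fun i => hasDerivWithinAt_pi.2 fun j => ?_
    have h1 := HasDerivWithinAt.fun_sum (u := Finset.univ) fun k _ =>
      ((hasDerivWithinAt_pi.1 (hR k)) j).const_mul ((g.1 : Mat3) i k)
    exact h1
  · exact hasDerivWithinAt_pi.2 fun k => (hz k).const_mul (g.2 k : ℂ)

/-- `f ε t` is a smooth variation, with fixed endpoints, of the curve `q` on `[t₀, t₁]`. -/
def IsVariation (q : ℝ → Q) (t₀ t₁ : ℝ) (f : ℝ → ℝ → Q) : Prop :=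
  SmoothMapOn (fun p : ℝ × ℝ => f p.1 p.2) (Set.univ ×ˢ Set.Icc t₀ t₁) ∧
    (∀ t ∈ Set.Icc t₀ t₁, f 0 t = q t) ∧ ∀ ε, f ε t₀ = q t₀ ∧ f ε t₁ = q t₁

/-- The curve `q` on `[t₀, t₁]` is critical for the action integral of the Lagrangian `L`. -/
def IsCritical (L : TQ → ℝ) (t₀ t₁ : ℝ) (q : ℝ → Q) : Prop :=
  ∀ f : ℝ → ℝ → Q, IsVariation q t₀ t₁ f →
    HasDerivAt (fun ε => ∫ t in t₀..t₁, L (tangentLift (f ε) (Set.Icc t₀ t₁) t)) 0 0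

/-! ### The reduced system on `so(3) ⊕ ℝ³` -/

/-- The Lie algebra `so(3) ⊕ ℝ³` of the symmetry group, with `so(3)` identified with `ℝ³`. -/
abbrev Alg : Type := R3 × R3

/-- The adjoint operator `u ↦ [v, u]` of the Lie algebra `so(3) ⊕ ℝ³`, where
`[(α₁, β₁), (α₂, β₂)] = (α₁ × α₂, 0)`. -/
noncomputable def ad (v : Alg) : Alg →L[ℝ] Alg :=
  ((LinearMap.toContinuousLinearMap (crossProduct v.1)).comp
    (ContinuousLinearMap.fst ℝ R3 R3)).prod 0

theorem ad_apply (v u : Alg) : ad v u = (v.1 ⨯₃ u.1, 0) := rfl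

/-- The coadjoint operator, `ad*_v μ (u) = μ [v, u]`. -/
noncomputable def coad (v : Alg) (μ : Alg →L[ℝ] ℝ) : Alg →L[ℝ] ℝ := μ.comp (ad v)

/-- The projection `(R, θ, Ṙ, θ̇) ↦ (Ω, Ω_r) = (R⁻¹ Ṙ, θ̇)`. -/
noncomputable def reduce (x : TQ) : Alg := (bodyVel x, rotorVel x)

/-- The reduced Lagrangian `ℓ (Ω, Ω_r)`. -/
noncomputable def reducedLagrangian (I K : Mat3) (v : Alg) : ℝ :=
  1 / 2 * (v.1 ⬝ᵥ (I *ᵥ v.1)) + 1 / 2 * ((v.1 + v.2) ⬝ᵥ (K *ᵥ (v.1 + v.2)))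

/-- `f ε t` is a smooth variation of the curve `v` on `[t₀, t₁]` such that `δv = ẇ + [v, w]` for a
smooth curve `w` in the Lie algebra that vanishes at the endpoints. -/
def IsReducedVariation (v : ℝ → Alg) (t₀ t₁ : ℝ) (f : ℝ → ℝ → Alg) : Prop :=
  ContDiffOn ℝ ∞ (fun p : ℝ × ℝ => f p.1 p.2) (Set.univ ×ˢ Set.Icc t₀ t₁) ∧
    (∀ t ∈ Set.Icc t₀ t₁, f 0 t = v t) ∧
    ∃ w : ℝ → Alg, ContDiffOn ℝ ∞ w (Set.Icc t₀ t₁) ∧ w t₀ = 0 ∧ w t₁ = 0 ∧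
      ∀ t ∈ Set.Icc t₀ t₁,
        HasDerivAt (fun ε => f ε t) (derivWithin w (Set.Icc t₀ t₁) t + ad (v t) (w t)) 0

/-- The curve `v` on `[t₀, t₁]` is critical for the constrained variational principle of the
reduced Lagrangian `l`. -/
def IsReducedCritical (l : Alg → ℝ) (t₀ t₁ : ℝ) (v : ℝ → Alg) : Prop :=
  ∀ f : ℝ → ℝ → Alg, IsReducedVariation v t₀ t₁ f →
    HasDerivAt (fun ε => ∫ t in t₀..t₁, l (f ε t)) 0 0

/-- The Euler–Poincaré equations `d/dt (∂l/∂v) = ad*_v (∂l/∂v)` on `[t₀, t₁]`, as equations in the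
dual of the Lie algebra. -/
def EulerPoincare (l : Alg → ℝ) (t₀ t₁ : ℝ) (v : ℝ → Alg) : Prop :=
  ∀ t ∈ Set.Icc t₀ t₁,
    HasDerivWithinAt (fun s => fderiv ℝ l (v s)) (coad (v t) (fderiv ℝ l (v t)))
      (Set.Icc t₀ t₁) t

/-- `(I + K) Ω̇ + K Ω̇_r = ((I + K) Ω + K Ω_r) × Ω` on `[t₀, t₁]`, for `v = (Ω, Ω_r)`. -/
def BodyEquation (I K : Mat3) (t₀ t₁ : ℝ) (v : ℝ → Alg) : Prop :=
  ∀ t ∈ Set.Icc t₀ t₁,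
    (I + K) *ᵥ derivWithin (fun s => (v s).1) (Set.Icc t₀ t₁) t +
        K *ᵥ derivWithin (fun s => (v s).2) (Set.Icc t₀ t₁) t =
      ((I + K) *ᵥ (v t).1 + K *ᵥ (v t).2) ⨯₃ (v t).1

/-- `K Ω̇_r + K Ω̇ = 0` on `[t₀, t₁]`, for `v = (Ω, Ω_r)`. -/
def RotorEquation (K : Mat3) (t₀ t₁ : ℝ) (v : ℝ → Alg) : Prop :=
  ∀ t ∈ Set.Icc t₀ t₁,
    K *ᵥ derivWithin (fun s => (v s).2) (Set.Icc t₀ t₁) t +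
      K *ᵥ derivWithin (fun s => (v s).1) (Set.Icc t₀ t₁) t = 0

/-- The curve `t ↦ (Ω t, Ω_r t)` on `[t₀, t₁]` obtained by reduction from a curve `q` in the
configuration space. -/
noncomputable def reducedCurve (q : ℝ → Q) (t₀ t₁ t : ℝ) : Alg :=
  reduce (tangentLift q (Set.Icc t₀ t₁) t)

/-! ### The momentum of the rotors -/

theorem isTangent_shift (x : TQ) (a : R3) :
    IsTangent x.1.1 (x.1.2.1, fun k => x.1.2.2 k + Complex.I * a k * x.1.1.2 k) := by
  refine ⟨x.2.1, fun k => ?_⟩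
  have h : (((x.1.1.2 k)⁻¹ : Circle) : ℂ) * (x.1.2.2 k + Complex.I * a k * x.1.1.2 k)
      = ((x.1.1.2 k)⁻¹ : Circle) * x.1.2.2 k + Complex.I * a k := by
    have hz : (x.1.1.2 k : ℂ) ≠ 0 := Circle.coe_ne_zero _
    rw [Circle.coe_inv]; field_simp
  have h2 := x.2.2 k
  change ((((x.1.1.2 k)⁻¹ : Circle) : ℂ) * (x.1.2.2 k + Complex.I * a k * x.1.1.2 k)).re = 0
  rw [h, Complex.add_re, h2]
  simp

/-- The tangent vector `x + a_Q`, where `a_Q (R, z) = (0, i a z)` is the infinitesimal generator of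
`a ∈ ℝ³` for the action of the torus by translations of the rotor angles. -/
noncomputable def shift (x : TQ) (a : R3) : TQ :=
  ⟨(x.1.1, (x.1.2.1, fun k => x.1.2.2 k + Complex.I * a k * x.1.1.2 k)), isTangent_shift x a⟩

/-- The momentum of the rotors, i.e. the Noether current `a ↦ ⟨∂L/∂q̇, a_Q⟩` of the action of the
torus. -/
noncomputable def rotorMomentum (L : TQ → ℝ) (x : TQ) (a : R3) : ℝ :=
  deriv (fun s : ℝ => L (shift x (s • a))) 0

end RotorBody

namespace RotorBody

/-! ### The quotient of the tangent bundle -/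

/-! Everything rests on the left trivialization `(q, q̇) ↦ q⁻¹ q̇`. It is invariant under the lifted
action, and every tangent vector is the translate by its base point of a unique vector at the
identity (`smul_tangentAtOne_reduce`). Hence the trivialization induces a bijection from the
quotient onto the Lie algebra, and the continuous section `tangentAtOne` makes it a homeomorphism.
The Lagrangian is by definition the reduced Lagrangian of the trivialized velocity. Freeness is that
of left translation on a group, and properness comes from compactness of the group.

For a curve in the algebra, integration by parts turns the first variation into the integral of the
Euler–Poincaré residual paired with `w` (`integral_variation_eq`); as `w` is arbitrary, the residual
vanishes (`eulerPoincare_of_integral_eq_zero`). The momenta of the quadratic Lagrangian are `(I + K)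
Ω + K Ω_r` and `K (Ω + Ω_r)`, and the triple product identity computes the coadjoint term; this
gives the equations in components.

The passage to the group uses that, with `w = q⁻¹ δq`, a variation of `q` induces `δv = ẇ + [v, w]`
(`hasDerivAt_reducedCurve_variation`): mixed partials commute, and what remains is the Maurer–Cartan
equation. Conversely every `w` vanishing at the endpoints is realized by multiplying `q` on the
right by the Cayley transform and the circle exponential of `ε w` (`generatedVariation`). Finally,
the rotor momentum is `K (Ω + Ω_r)`, whose derivative is the left side of the rotor equation. -/

theorem bodyMatrix_smul (g : Q) (x : TQ) :
    bodyMatrix (g • x).1.1.1 (g • x).1.2.1 = bodyMatrix x.1.1.1 x.1.2.1 := by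
  change ((g.1 * x.1.1.1 : SO3)⁻¹ : SO3).1 * ((g.1 : Mat3) * Matrix.of x.1.2.1) = _
  have h1 : ((g.1⁻¹ : SO3) : Mat3) * (g.1 : Mat3) = 1 := by
    rw [← Submonoid.coe_mul, inv_mul_cancel, Submonoid.coe_one]
  rw [mul_inv_rev, Submonoid.coe_mul, Matrix.mul_assoc, ← Matrix.mul_assoc _ (g.1 : Mat3), h1,
    Matrix.one_mul]
  rfl

theorem bodyVel_smul (g : Q) (x : TQ) : bodyVel (g • x) = bodyVel x := by
  rw [bodyVel, bodyMatrix_smul]; rfl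

theorem rotorVel_smul (g : Q) (x : TQ) : rotorVel (g • x) = rotorVel x := by
  funext k
  change ((((g.2 k * x.1.1.2 k)⁻¹ : Circle) : ℂ) * ((g.2 k : ℂ) * x.1.2.2 k)).im = _
  congr 1
  have hg : (g.2 k : ℂ) ≠ 0 := Circle.coe_ne_zero _
  simp only [mul_inv_rev, Circle.coe_mul, Circle.coe_inv]
  field_simp

theorem reduce_smul (g : Q) (x : TQ) : reduce (g • x) = reduce x := by
  rw [reduce, bodyVel_smul, rotorVel_smul]; rfl

theorem lagrangian_eq (I K : Mat3) (x : TQ) :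
    lagrangian I K x = reducedLagrangian I K (reduce x) := rfl

/-- Base points already move by left multiplication in the group, which is free. -/
theorem eq_one_of_smul_eq (g : Q) (x : TQ) (h : g • x = x) : g = 1 :=
  mul_eq_right.1 (congrArg (fun y : TQ => y.1.1) h)

/-! ### Compactness of the group and properness of the action. -/

theorem transpose_mul_self_SO3 (R : SO3) : (R : Mat3)ᵀ * (R : Mat3) = 1 := by
  rw [← coe_inv_SO3, ← Submonoid.coe_mul, inv_mul_cancel, Submonoid.coe_one]

theorem mul_transpose_self_SO3 (R : SO3) : (R : Mat3) * (R : Mat3)ᵀ = 1 := by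
  rw [← coe_inv_SO3, ← Submonoid.coe_mul, mul_inv_cancel, Submonoid.coe_one]

theorem mem_SO3_iff (A : Mat3) :
    A ∈ Matrix.specialOrthogonalGroup (Fin 3) ℝ ↔ Aᵀ * A = 1 ∧ A.det = 1 := by
  rw [Matrix.mem_specialOrthogonalGroup_iff, Matrix.mem_orthogonalGroup_iff']

instance : CompactSpace SO3 := by
  refine isCompact_iff_compactSpace.1 ?_
  have hK : IsCompact (Set.univ.pi fun _ : Fin 3 => Set.univ.pi fun _ : Fin 3 =>
      Set.Icc (-1 : ℝ) 1) := isCompact_univ_pi fun _ => isCompact_univ_pi fun _ => isCompact_Icc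
  have hclosed : IsClosed {A : Mat3 | Aᵀ * A = 1 ∧ A.det = 1} :=
    (isClosed_eq (by fun_prop) continuous_const).inter
      (isClosed_eq (Continuous.matrix_det continuous_id) continuous_const)
  have hset : ((Matrix.specialOrthogonalGroup (Fin 3) ℝ : Submonoid Mat3) : Set Mat3)
      = {A : Mat3 | Aᵀ * A = 1 ∧ A.det = 1} := Set.ext mem_SO3_iff
  rw [hset]
  -- The columns of an orthogonal matrix are unit vectors, so all entries lie in `[-1, 1]`.
  refine hK.of_isClosed_subset hclosed fun A hA i _ j _ => abs_le.1 ?_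
  have h1 : ∑ k, A k j * A k j = 1 := by
    have := congrFun (congrFun hA.1 j) j
    rwa [Matrix.one_apply_eq] at this
  have h2 : A i j * A i j ≤ 1 := h1 ▸
    Finset.single_le_sum (f := fun k => A k j * A k j) (fun k _ => mul_self_nonneg _)
      (Finset.mem_univ i)
  exact abs_le_one_iff_mul_self_le_one.2 h2

theorem continuous_coe_SO3 : Continuous fun R : SO3 => (R : Mat3) := continuous_subtype_val

theorem continuous_coe_TQ : Continuous fun x : TQ => (x.1 : Q × Amb) := continuous_subtype_val

instance : ContinuousSMul Q TQ := by
  refine ⟨Continuous.subtype_mk (Continuous.prodMk ?_ (Continuous.prodMk ?_ ?_)) _⟩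
  · exact continuous_fst.mul (continuous_fst.comp (continuous_coe_TQ.comp continuous_snd))
  · have h1 : Continuous fun p : Q × TQ => (p.1.1 : Mat3) :=
      continuous_coe_SO3.comp (continuous_fst.comp continuous_fst)
    have h2 : Continuous fun p : Q × TQ => (Matrix.of p.2.1.2.1 : Mat3) :=
      continuous_fst.comp (continuous_snd.comp (continuous_coe_TQ.comp continuous_snd))
    exact Continuous.matrix_mul h1 h2
  · refine continuous_pi fun k => ?_
    have h1 : Continuous fun p : Q × TQ => ((p.1.2 k : Circle) : ℂ) := by fun_prop
    have h2 : Continuous fun p : Q × TQ => p.2.1.2.2 k := by fun_prop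
    exact h1.mul h2

/-- The map `(g, x) ↦ (g • x, x)` followed by the second projection is the projection `Q × TQ → TQ`,
proper because `Q` is compact; a continuous first factor of a proper composite is proper when the
middle space is Hausdorff. -/
instance : ProperSMul Q TQ where
  isProperMap_smul_pair :=
    isProperMap_of_comp_of_t2 (by fun_prop) continuous_snd
      (isProperMap_snd_of_compactSpace (X := Q) (Y := TQ))

theorem continuous_hat : Continuous hat := by
  refine continuous_matrix fun i j => ?_
  fin_cases i <;> fin_cases j <;> simp [hat] <;> fun_prop

theorem continuous_bodyVel : Continuous bodyVel := by
  have h1 : Continuous fun x : TQ => (x.1.1.1 : Mat3)ᵀ :=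
    (continuous_coe_SO3.comp
      (continuous_fst.comp (continuous_fst.comp continuous_coe_TQ))).matrix_transpose
  have h2 : Continuous fun x : TQ => (Matrix.of x.1.2.1 : Mat3) :=
    continuous_fst.comp (continuous_snd.comp continuous_coe_TQ)
  have h := h1.matrix_mul h2
  refine continuous_pi fun k => ?_
  fin_cases k
  · exact h.matrix_elem 2 1
  · exact h.matrix_elem 0 2
  · exact h.matrix_elem 1 0

theorem continuous_rotorVel : Continuous rotorVel := by
  refine continuous_pi fun k => Complex.continuous_im.comp (Continuous.mul ?_ ?_) <;> fun_prop

theorem continuous_reduce : Continuous reduce :=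
  continuous_bodyVel.prodMk continuous_rotorVel

/-! ### The global section of the quotient map. -/

theorem hat_transpose (v : R3) : (hat v)ᵀ = -hat v := by
  ext i j
  fin_cases i <;> fin_cases j <;> simp [hat]

/-- The tangent vector at the identity with given angular velocities. -/
noncomputable def tangentAtOne (v : Alg) : TQ :=
  ⟨(1, (hat v.1, fun k => Complex.I * v.2 k)), by
    refine ⟨?_, fun k => by simp⟩
    have h : bodyMatrix (1 : Q).1 (hat v.1) = hat v.1 := by
      simp [bodyMatrix]; rfl
    change (bodyMatrix (1 : Q).1 (hat v.1))ᵀ = -bodyMatrix (1 : Q).1 (hat v.1)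
    rw [h, hat_transpose]⟩

theorem continuous_tangentAtOne : Continuous tangentAtOne := by
  refine Continuous.subtype_mk (continuous_const.prodMk (Continuous.prodMk ?_ (by fun_prop))) _
  exact continuous_hat.comp continuous_fst

theorem reduce_tangentAtOne (v : Alg) : reduce (tangentAtOne v) = v := by
  refine Prod.ext ?_ (funext fun k => ?_)
  · have h : bodyMatrix (1 : Q).1 (hat v.1) = hat v.1 := by
      simp [bodyMatrix]; rfl
    change vee (bodyMatrix (1 : Q).1 (hat v.1)) = v.1
    rw [h, vee_hat]
  · change ((((1 : Circle)⁻¹ : Circle) : ℂ) * (Complex.I * v.2 k)).im = v.2 k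
    simp

theorem smul_tangentAtOne_reduce (x : TQ) : x.1.1 • tangentAtOne (reduce x) = x := by
  apply Subtype.ext
  refine Prod.ext (mul_one _) (Prod.ext ?_ (funext fun k => ?_))
  · change (x.1.1.1 : Mat3) * hat (vee (bodyMatrix x.1.1.1 x.1.2.1)) = x.1.2.1
    rw [hat_vee _ x.2.1, bodyMatrix, coe_inv_SO3, ← Matrix.mul_assoc, mul_transpose_self_SO3,
      Matrix.one_mul]
    rfl
  · change (x.1.1.2 k : ℂ) * (Complex.I *
      (((((x.1.1.2 k)⁻¹ : Circle) * x.1.2.2 k : ℂ).im : ℝ) : ℂ)) = x.1.2.2 k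
    have h := x.2.2 k
    -- Tangency makes `z⁻¹ ż` purely imaginary, so it is recovered from its imaginary part.
    have h2 : (Complex.I * (((((x.1.1.2 k)⁻¹ : Circle) * x.1.2.2 k : ℂ).im : ℝ) : ℂ))
        = ((x.1.1.2 k)⁻¹ : Circle) * x.1.2.2 k := by
      apply Complex.ext
      · rw [h]; simp
      · simp
    rw [h2, ← mul_assoc, ← Circle.coe_mul, mul_inv_cancel, Circle.coe_one, one_mul]

/-- The quotient of the tangent bundle by the lifted action is the Lie algebra. -/
noncomputable def quotientHomeomorph : MulAction.orbitRel.Quotient Q TQ ≃ₜ Alg where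
  toFun := Quotient.lift reduce (by
    rintro _ x ⟨g, rfl⟩
    exact reduce_smul g x)
  invFun v := Quotient.mk _ (tangentAtOne v)
  left_inv := by
    rintro ⟨x⟩
    refine Quotient.sound ((MulAction.orbitRel Q TQ).symm ?_)
    exact ⟨x.1.1, smul_tangentAtOne_reduce x⟩
  right_inv := reduce_tangentAtOne
  continuous_toFun := continuous_reduce.quotient_lift _
  continuous_invFun := continuous_quotient_mk'.comp continuous_tangentAtOne

/-! ### The reduced Lagrangian -/

theorem contDiff_mulVec (A : Mat3) : ContDiff ℝ ∞ fun u : R3 => A *ᵥ u :=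
  (LinearMap.toContinuousLinearMap (Matrix.mulVecLin A)).contDiff

theorem contDiff_dotProduct {E : Type*} [NormedAddCommGroup E] [NormedSpace ℝ E] {f g : E → R3}
    (hf : ContDiff ℝ ∞ f) (hg : ContDiff ℝ ∞ g) : ContDiff ℝ ∞ fun x => f x ⬝ᵥ g x :=
  ContDiff.sum fun i _ => (contDiff_pi.1 hf i).mul (contDiff_pi.1 hg i)

theorem contDiff_reducedLagrangian (I K : Mat3) : ContDiff ℝ ∞ (reducedLagrangian I K) := by
  have h12 : ContDiff ℝ ∞ fun v : Alg => v.1 + v.2 := contDiff_fst.add contDiff_snd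
  exact (contDiff_const.mul
    (contDiff_dotProduct contDiff_fst ((contDiff_mulVec I).comp contDiff_fst))).add
    (contDiff_const.mul (contDiff_dotProduct h12 ((contDiff_mulVec K).comp h12)))

theorem dotProduct_mulVec_comm_of_isSymm {A : Mat3} (hA : A.IsSymm) (u v : R3) :
    u ⬝ᵥ (A *ᵥ v) = (A *ᵥ u) ⬝ᵥ v := by
  rw [Matrix.dotProduct_mulVec, ← Matrix.mulVec_transpose, hA.eq]

theorem hasDerivAt_quadratic (a b c : ℝ) : HasDerivAt (fun s => a + s * b + s ^ 2 * c) b 0 := by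
  have h := (((hasDerivAt_id (0 : ℝ)).mul_const b).const_add a).add
    (((hasDerivAt_id (0 : ℝ)).pow 2).mul_const c)
  convert! h using 1
  · simp

/-- Along a line the quadratic form is exactly the polynomial `ℓ(v) + s b + s² ℓ(u)`; symmetry of
`I` and `K` merges the two cross terms into `b`. -/
theorem hasDerivAt_reducedLagrangian {I K : Mat3} (hI : I.IsSymm) (hK : K.IsSymm) (v u : Alg) :
    HasDerivAt (fun s : ℝ => reducedLagrangian I K (v + s • u))
      (((I + K) *ᵥ v.1 + K *ᵥ v.2) ⬝ᵥ u.1 + (K *ᵥ (v.1 + v.2)) ⬝ᵥ u.2) 0 := by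
  convert hasDerivAt_quadratic (reducedLagrangian I K v)
    (((I + K) *ᵥ v.1 + K *ᵥ v.2) ⬝ᵥ u.1 + (K *ᵥ (v.1 + v.2)) ⬝ᵥ u.2)
    (reducedLagrangian I K u) using 1
  funext s
  simp only [reducedLagrangian, Prod.fst_add, Prod.snd_add, Prod.smul_fst, Prod.smul_snd,
    Matrix.mulVec_add, Matrix.add_mulVec, Matrix.mulVec_smul, dotProduct_add, add_dotProduct,
    smul_dotProduct, dotProduct_smul, smul_eq_mul, ← dotProduct_mulVec_comm_of_isSymm hI,
    ← dotProduct_mulVec_comm_of_isSymm hK]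
  rw [dotProduct_comm u.1 (I *ᵥ v.1), dotProduct_comm u.1 (K *ᵥ v.1),
    dotProduct_comm u.1 (K *ᵥ v.2), dotProduct_comm u.2 (K *ᵥ v.1), dotProduct_comm u.2 (K *ᵥ v.2)]
  simp only [← dotProduct_mulVec_comm_of_isSymm hI, ← dotProduct_mulVec_comm_of_isSymm hK]
  ring

theorem fderiv_reducedLagrangian {I K : Mat3} (hI : I.IsSymm) (hK : K.IsSymm) (v u : Alg) :
    fderiv ℝ (reducedLagrangian I K) v u =
      ((I + K) *ᵥ v.1 + K *ᵥ v.2) ⬝ᵥ u.1 + (K *ᵥ (v.1 + v.2)) ⬝ᵥ u.2 := by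
  have h1 : HasFDerivAt (reducedLagrangian I K) (fderiv ℝ (reducedLagrangian I K) v)
      (v + (0 : ℝ) • u) := by
    rw [zero_smul, add_zero]
    exact ((contDiff_reducedLagrangian I K).differentiable (by simp) v).hasFDerivAt
  have h2 : HasDerivAt (fun s : ℝ => v + s • u) u 0 := by
    simpa using ((hasDerivAt_id (0 : ℝ)).smul_const u).const_add v
  have h3 : HasDerivAt (fun s : ℝ => reducedLagrangian I K (v + s • u))
      (fderiv ℝ (reducedLagrangian I K) v u) 0 :=
    HasFDerivAt.comp_hasDerivAt (f := fun s : ℝ => v + s • u) (0 : ℝ) h1 h2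
  exact h3.unique (hasDerivAt_reducedLagrangian hI hK v u)

/-! ### The momentum of the rotors -/

theorem reduce_shift (x : TQ) (a : R3) : reduce (shift x a) = reduce x + (0, a) := by
  refine Prod.ext ?_ (funext fun k => ?_)
  · change bodyVel x = bodyVel x + 0
    rw [add_zero]
  · change ((((x.1.1.2 k)⁻¹ : Circle) : ℂ) *
      (x.1.2.2 k + Complex.I * a k * x.1.1.2 k)).im = rotorVel x k + a k
    have h : (((x.1.1.2 k)⁻¹ : Circle) : ℂ) * (x.1.2.2 k + Complex.I * a k * x.1.1.2 k)
        = ((x.1.1.2 k)⁻¹ : Circle) * x.1.2.2 k + Complex.I * a k := by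
      have hz : (x.1.1.2 k : ℂ) ≠ 0 := Circle.coe_ne_zero _
      rw [Circle.coe_inv]; field_simp
    rw [h, Complex.add_im, rotorVel]
    simp

/-- Adding the generator of `a` to a velocity shifts the reduced velocity by `(0, a)`, so the
momentum is the derivative of `ℓ` in that direction. -/
theorem rotorMomentum_lagrangian {I K : Mat3} (hI : I.IsSymm) (hK : K.IsSymm) (x : TQ) (a : R3) :
    rotorMomentum (lagrangian I K) x a = (K *ᵥ (bodyVel x + rotorVel x)) ⬝ᵥ a := by
  have h : (fun s : ℝ => lagrangian I K (shift x (s • a)))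
      = fun s : ℝ => reducedLagrangian I K (reduce x + s • ((0, a) : Alg)) := by
    funext s
    rw [lagrangian_eq, reduce_shift, Prod.smul_mk, smul_zero]
  rw [rotorMomentum, h, (hasDerivAt_reducedLagrangian hI hK _ _).deriv, dotProduct_zero, zero_add]
  rfl

/-! ### The Euler–Poincaré equations in components -/

theorem hasDerivWithinAt_mulVec {u : ℝ → R3} {u' : R3} {S : Set ℝ} {t : ℝ} (A : Mat3)
    (h : HasDerivWithinAt u u' S t) : HasDerivWithinAt (fun s => A *ᵥ u s) (A *ᵥ u') S t :=
  (LinearMap.toContinuousLinearMap (Matrix.mulVecLin A)).hasFDerivAt.comp_hasDerivWithinAt t h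

/-- The linear map that sends a pair of momenta to a covector of the Lie algebra. -/
noncomputable def covector : Alg →L[ℝ] Alg →L[ℝ] ℝ :=
  LinearMap.toContinuousLinearMap
    (LinearMap.toContinuousLinearMap.toLinearMap.comp
      (LinearMap.mk₂ ℝ (fun p u : Alg => p.1 ⬝ᵥ u.1 + p.2 ⬝ᵥ u.2)
        (fun p q u => by simp only [Prod.fst_add, Prod.snd_add, add_dotProduct]; ring)
        (fun c p u => by simp [smul_dotProduct, mul_add])
        (fun p u v => by simp only [Prod.fst_add, Prod.snd_add, dotProduct_add]; ring)
        (fun c p u => by simp [dotProduct_smul, mul_add])))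

theorem covector_apply (p u : Alg) : covector p u = p.1 ⬝ᵥ u.1 + p.2 ⬝ᵥ u.2 := rfl

/-- Allows an equation between covectors to be read off as a pair of equations in `ℝ³`. -/
theorem covector_injective : Function.Injective covector := by
  intro p q h
  refine Prod.ext (dotProduct_eq _ _ fun u => ?_) (dotProduct_eq _ _ fun u => ?_)
  · simpa [covector_apply] using DFunLike.congr_fun h (u, 0)
  · simpa [covector_apply] using DFunLike.congr_fun h (0, u)

theorem fderiv_reducedLagrangian_eq_covector {I K : Mat3} (hI : I.IsSymm) (hK : K.IsSymm)
    (v : Alg) : fderiv ℝ (reducedLagrangian I K) v =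
      covector ((I + K) *ᵥ v.1 + K *ᵥ v.2, K *ᵥ (v.1 + v.2)) :=
  ContinuousLinearMap.ext fun u => fderiv_reducedLagrangian hI hK v u

/-- Cyclic invariance of the triple product: `p · (v × u) = (p × v) · u`. The second component
vanishes because the torus factor is abelian. -/
theorem coad_covector (v p : Alg) : coad v (covector p) = covector (p.1 ⨯₃ v.1, 0) := by
  refine ContinuousLinearMap.ext fun u => ?_
  change p.1 ⬝ᵥ (v.1 ⨯₃ u.1) + p.2 ⬝ᵥ (0 : R3) = (p.1 ⨯₃ v.1) ⬝ᵥ u.1 + (0 : R3) ⬝ᵥ u.2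
  rw [dotProduct_zero, zero_dotProduct, triple_product_permutation, triple_product_permutation,
    dotProduct_comm]

theorem eulerPoincare_iff {I K : Mat3} (hI : I.IsSymm) (hK : K.IsSymm) {t₀ t₁ : ℝ} (ht : t₀ < t₁)
    {v : ℝ → Alg} (hv : DifferentiableOn ℝ v (Set.Icc t₀ t₁)) :
    EulerPoincare (reducedLagrangian I K) t₀ t₁ v ↔
      BodyEquation I K t₀ t₁ v ∧ RotorEquation K t₀ t₁ v := by
  rw [BodyEquation, RotorEquation, EulerPoincare, ← forall₂_and]
  refine forall₂_congr fun t hts => ?_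
  have h1 := (hv t hts).fst.hasDerivWithinAt
  have h2 := (hv t hts).snd.hasDerivWithinAt
  have hp := covector.hasFDerivAt.comp_hasDerivWithinAt t
    (((hasDerivWithinAt_mulVec (I + K) h1).add (hasDerivWithinAt_mulVec K h2)).prodMk
      (hasDerivWithinAt_mulVec K (h1.add h2)))
  have hfun : (fun s => fderiv ℝ (reducedLagrangian I K) (v s)) = fun s =>
      covector ((I + K) *ᵥ (v s).1 + K *ᵥ (v s).2, K *ᵥ ((v s).1 + (v s).2)) :=
    funext fun s => fderiv_reducedLagrangian_eq_covector hI hK (v s)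
  rw [hfun, fderiv_reducedLagrangian_eq_covector hI hK, coad_covector]
  have huniq : UniqueDiffWithinAt ℝ (Set.Icc t₀ t₁) t := uniqueDiffOn_Icc ht t hts
  constructor
  · intro h
    have h3 := covector_injective (huniq.eq_deriv _ hp h)
    refine ⟨congrArg Prod.fst h3, ?_⟩
    rw [add_comm, ← Matrix.mulVec_add]
    exact congrArg Prod.snd h3
  · rintro ⟨h3, h4⟩
    rw [add_comm, ← Matrix.mulVec_add] at h4
    have := hp
    rw [h3, h4] at this
    exact this

theorem rotorEquation_iff_const {K : Mat3} {t₀ t₁ : ℝ} (ht : t₀ < t₁)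
    {v : ℝ → Alg} (hv : DifferentiableOn ℝ v (Set.Icc t₀ t₁)) :
    RotorEquation K t₀ t₁ v ↔
      ∀ t ∈ Set.Icc t₀ t₁, K *ᵥ ((v t).1 + (v t).2) = K *ᵥ ((v t₀).1 + (v t₀).2) := by
  have hp : ∀ t ∈ Set.Icc t₀ t₁, HasDerivWithinAt (fun s => K *ᵥ ((v s).1 + (v s).2))
      (K *ᵥ derivWithin (fun s => (v s).2) (Set.Icc t₀ t₁) t +
        K *ᵥ derivWithin (fun s => (v s).1) (Set.Icc t₀ t₁) t) (Set.Icc t₀ t₁) t := by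
    intro t hts
    rw [← Matrix.mulVec_add, add_comm]
    exact hasDerivWithinAt_mulVec K
      ((hv t hts).fst.hasDerivWithinAt.add (hv t hts).snd.hasDerivWithinAt)
  constructor
  · intro h
    refine constant_of_derivWithin_zero (fun t hts => (hp t hts).differentiableWithinAt)
      fun t hts => ?_
    have hts' := Set.Ico_subset_Icc_self hts
    rw [(hp t hts').derivWithin (uniqueDiffOn_Icc ht t hts'), h t hts']
  · intro h t hts
    refine (uniqueDiffOn_Icc ht t hts).eq_deriv _ (hp t hts) ?_
    exact (hasDerivWithinAt_const t _ _).congr h (h t hts)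

/-! ### The reduced variational principle -/

/-- Partial derivative of a smooth function on `ℝ × [t₀, t₁]` in the first variable. -/
theorem hasDerivAt_fst_of_contDiffOn {F : Type*} [NormedAddCommGroup F] [NormedSpace ℝ F]
    {g : ℝ → ℝ → F} {S : Set ℝ}
    (hg : ContDiffOn ℝ ∞ (fun p : ℝ × ℝ => g p.1 p.2) (Set.univ ×ˢ S)) {t : ℝ} (ht : t ∈ S)
    (ε : ℝ) :
    HasDerivAt (fun e => g e t)
      (fderivWithin ℝ (fun p : ℝ × ℝ => g p.1 p.2) (Set.univ ×ˢ S) (ε, t) (1, 0)) ε := by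
  have h1 := ((hg.differentiableOn (by simp)) (ε, t) ⟨trivial, ht⟩).hasFDerivWithinAt
  have h2 : HasDerivAt (fun e : ℝ => (e, t)) ((1 : ℝ), (0 : ℝ)) ε :=
    (hasDerivAt_id ε).prodMk (hasDerivAt_const ε t)
  exact HasFDerivWithinAt.comp_hasDerivAt (f := fun e : ℝ => (e, t)) ε h1 h2
    (Filter.Eventually.of_forall fun e => ⟨trivial, ht⟩)

/-- Partial derivative of a smooth function on `ℝ × [t₀, t₁]` in the second variable. -/
theorem hasDerivWithinAt_snd_of_contDiffOn {F : Type*} [NormedAddCommGroup F] [NormedSpace ℝ F]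
    {g : ℝ → ℝ → F} {S : Set ℝ}
    (hg : ContDiffOn ℝ ∞ (fun p : ℝ × ℝ => g p.1 p.2) (Set.univ ×ˢ S)) {t : ℝ} (ht : t ∈ S)
    (ε : ℝ) :
    HasDerivWithinAt (g ε)
      (fderivWithin ℝ (fun p : ℝ × ℝ => g p.1 p.2) (Set.univ ×ˢ S) (ε, t) (0, 1)) S t := by
  have h1 := ((hg.differentiableOn (by simp)) (ε, t) ⟨trivial, ht⟩).hasFDerivWithinAt
  have h2 : HasDerivWithinAt (fun s : ℝ => (ε, s)) ((0 : ℝ), (1 : ℝ)) S t :=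
    (hasDerivWithinAt_const t S ε).prodMk (hasDerivWithinAt_id t S)
  exact HasFDerivWithinAt.comp_hasDerivWithinAt (f := fun s : ℝ => (ε, s)) t h1 h2
    (fun s hs => ⟨trivial, hs⟩)

theorem uniqueDiffOn_univ_prod_Icc {t₀ t₁ : ℝ} (ht : t₀ < t₁) :
    UniqueDiffOn ℝ ((Set.univ : Set ℝ) ×ˢ Set.Icc t₀ t₁) :=
  uniqueDiffOn_univ.prod (uniqueDiffOn_Icc ht)

/-- Differentiation under the integral sign. -/
theorem hasDerivAt_intervalIntegral_of_contDiffOn {t₀ t₁ : ℝ} (ht : t₀ < t₁) {g : ℝ → ℝ → ℝ}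
    (hg : ContDiffOn ℝ ∞ (fun p : ℝ × ℝ => g p.1 p.2) (Set.univ ×ˢ Set.Icc t₀ t₁)) {g' : ℝ → ℝ}
    (hg' : ∀ t ∈ Set.Icc t₀ t₁, HasDerivAt (fun ε => g ε t) (g' t) 0) :
    HasDerivAt (fun ε => ∫ t in t₀..t₁, g ε t) (∫ t in t₀..t₁, g' t) 0 := by
  set G : ℝ → ℝ → ℝ := fun ε t =>
    fderivWithin ℝ (fun p : ℝ × ℝ => g p.1 p.2) (Set.univ ×ˢ Set.Icc t₀ t₁) (ε, t) (1, 0) with hG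
  have hGc : ContinuousOn (fun p : ℝ × ℝ => G p.1 p.2) (Set.univ ×ˢ Set.Icc t₀ t₁) :=
    (hg.continuousOn_fderivWithin (uniqueDiffOn_univ_prod_Icc ht) (by simp)).clm_apply
      continuousOn_const
  have hslice : ∀ {φ : ℝ → ℝ → ℝ}, ContinuousOn (fun p : ℝ × ℝ => φ p.1 p.2)
      (Set.univ ×ˢ Set.Icc t₀ t₁) → ∀ ε, ContinuousOn (φ ε) (Set.uIcc t₀ t₁) := by
    intro φ hφ ε
    rw [Set.uIcc_of_le ht.le]
    exact hφ.comp (f := fun t : ℝ => (ε, t)) (by fun_prop) fun t hts => ⟨trivial, hts⟩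
  -- A bound for the `ε`-derivative on the compact rectangle `[-1, 1] × [t₀, t₁]` serves as a
  -- constant dominating function.
  obtain ⟨C, hC⟩ := (isCompact_Icc (a := (-1 : ℝ)) (b := 1)).prod (isCompact_Icc (a := t₀) (b := t₁))
    |>.exists_bound_of_continuousOn (hGc.mono (Set.prod_mono (Set.subset_univ _) subset_rfl))
  have hsub : Set.uIoc t₀ t₁ ⊆ Set.Icc t₀ t₁ := by
    rw [Set.uIoc_of_le ht.le]; exact Set.Ioc_subset_Icc_self
  have hmain := (intervalIntegral.hasDerivAt_integral_of_dominated_loc_of_deriv_le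
    (F := g) (F' := G) (x₀ := 0) (μ := MeasureTheory.volume) (a := t₀) (b := t₁)
    (bound := fun _ => C) (s := Set.Icc (-1) 1) (Icc_mem_nhds (by norm_num) (by norm_num))
    (Filter.Eventually.of_forall fun ε =>
      (hslice hg.continuousOn ε).intervalIntegrable.def'.aestronglyMeasurable)
    (hslice hg.continuousOn 0).intervalIntegrable
    (hslice hGc 0).intervalIntegrable.def'.aestronglyMeasurable
    (Filter.Eventually.of_forall fun t hts ε hε => hC (ε, t) ⟨hε, hsub hts⟩)
    intervalIntegrable_const
    (Filter.Eventually.of_forall fun t hts ε _ =>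
      hasDerivAt_fst_of_contDiffOn hg (hsub hts) ε)).2
  have heq : ∫ t in t₀..t₁, g' t = ∫ t in t₀..t₁, G 0 t := by
    refine intervalIntegral.integral_congr fun t hts => ?_
    rw [Set.uIcc_of_le ht.le] at hts
    exact (hg' t hts).unique (hasDerivAt_fst_of_contDiffOn hg hts 0)
  rw [heq]
  exact hmain

/-- The first variation of the action of a smooth Lagrangian on the Lie algebra. -/
theorem hasDerivAt_reducedAction {l : Alg → ℝ} (hl : ContDiff ℝ ∞ l) {t₀ t₁ : ℝ} (ht : t₀ < t₁)
    {f : ℝ → ℝ → Alg} {v δ : ℝ → Alg}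
    (hf : ContDiffOn ℝ ∞ (fun p : ℝ × ℝ => f p.1 p.2) (Set.univ ×ˢ Set.Icc t₀ t₁))
    (hfv : ∀ t ∈ Set.Icc t₀ t₁, f 0 t = v t)
    (hδ : ∀ t ∈ Set.Icc t₀ t₁, HasDerivAt (fun ε => f ε t) (δ t) 0) :
    HasDerivAt (fun ε => ∫ t in t₀..t₁, l (f ε t)) (∫ t in t₀..t₁, fderiv ℝ l (v t) (δ t)) 0 := by
  refine hasDerivAt_intervalIntegral_of_contDiffOn ht (g := fun ε t => l (f ε t))
    (hl.comp_contDiffOn hf) fun t hts => ?_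
  rw [← hfv t hts]
  exact HasFDerivAt.comp_hasDerivAt (f := fun ε => f ε t) (0 : ℝ)
    ((hl.differentiable (by simp)) (f 0 t)).hasFDerivAt (hδ t hts)

theorem contDiffOn_derivWithin_Icc {F : Type*} [NormedAddCommGroup F] [NormedSpace ℝ F]
    {t₀ t₁ : ℝ} (ht : t₀ < t₁) {w : ℝ → F} (hw : ContDiffOn ℝ ∞ w (Set.Icc t₀ t₁)) :
    ContDiffOn ℝ ∞ (derivWithin w (Set.Icc t₀ t₁)) (Set.Icc t₀ t₁) :=
  hw.derivWithin (uniqueDiffOn_Icc ht) (by simp)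

theorem contDiff_cross : ContDiff ℝ ∞ fun p : R3 × R3 => p.1 ⨯₃ p.2 := by
  refine contDiff_pi.2 fun i => ?_
  have h1 : ∀ j, ContDiff ℝ ∞ fun p : R3 × R3 => p.1 j := fun j => by fun_prop
  have h2 : ∀ j, ContDiff ℝ ∞ fun p : R3 × R3 => p.2 j := fun j => by fun_prop
  fin_cases i
  · simpa [cross_apply] using ((h1 1).mul (h2 2)).sub ((h1 2).mul (h2 1))
  · simpa [cross_apply] using ((h1 2).mul (h2 0)).sub ((h1 0).mul (h2 2))
  · simpa [cross_apply] using ((h1 0).mul (h2 1)).sub ((h1 1).mul (h2 0))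

theorem contDiffOn_ad {S : Set ℝ} {v w : ℝ → Alg} (hv : ContDiffOn ℝ ∞ v S)
    (hw : ContDiffOn ℝ ∞ w S) : ContDiffOn ℝ ∞ (fun t => ad (v t) (w t)) S :=
  (contDiff_cross.comp_contDiffOn (hv.fst.prodMk hw.fst)).prodMk contDiffOn_const

/-- Integration by parts in the first variation of the action. -/
theorem integral_variation_eq {l : Alg → ℝ} (hl : ContDiff ℝ ∞ l) {t₀ t₁ : ℝ} (ht : t₀ < t₁)
    {v w : ℝ → Alg} (hv : ContDiffOn ℝ ∞ v (Set.Icc t₀ t₁))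
    (hw : ContDiffOn ℝ ∞ w (Set.Icc t₀ t₁)) (hw₀ : w t₀ = 0) (hw₁ : w t₁ = 0) :
    ∫ t in t₀..t₁, fderiv ℝ l (v t) (derivWithin w (Set.Icc t₀ t₁) t + ad (v t) (w t)) =
      ∫ t in t₀..t₁, (coad (v t) (fderiv ℝ l (v t)) -
        derivWithin (fun s => fderiv ℝ l (v s)) (Set.Icc t₀ t₁) t) (w t) := by
  have hm : ContDiffOn ℝ ∞ (fun s => fderiv ℝ l (v s)) (Set.Icc t₀ t₁) :=
    (hl.fderiv_right (m := ∞) (by simp)).comp_contDiffOn hv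
  have hw' := contDiffOn_derivWithin_Icc ht hw
  have hm' := contDiffOn_derivWithin_Icc ht hm
  have hint : ∀ {φ : ℝ → ℝ}, ContDiffOn ℝ ∞ φ (Set.Icc t₀ t₁) →
      IntervalIntegrable φ MeasureTheory.volume t₀ t₁ := fun h =>
    ContinuousOn.intervalIntegrable (by rw [Set.uIcc_of_le ht.le]; exact h.continuousOn)
  have h1 := hm.clm_apply (hw'.add (contDiffOn_ad hv hw))
  have h2 : ContDiffOn ℝ ∞ (fun t => (coad (v t) (fderiv ℝ l (v t)) -
      derivWithin (fun s => fderiv ℝ l (v s)) (Set.Icc t₀ t₁) t) (w t)) (Set.Icc t₀ t₁) :=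
    (hm.clm_apply (contDiffOn_ad hv hw)).sub (hm'.clm_apply hw)
  -- The integrand is the derivative of `t ↦ ⟨∂l/∂v, w⟩`, and `w` vanishes at both endpoints.
  have h3 : ∫ t in t₀..t₁, (derivWithin (fun s => fderiv ℝ l (v s)) (Set.Icc t₀ t₁) t (w t) +
      fderiv ℝ l (v t) (derivWithin w (Set.Icc t₀ t₁) t)) = 0 := by
    rw [intervalIntegral.integral_eq_sub_of_hasDerivAt_of_le ht.le
      (f := fun t => fderiv ℝ l (v t) (w t)) (hm.clm_apply hw).continuousOn ?_
      (hint ((hm'.clm_apply hw).add (hm.clm_apply hw')))]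
    · simp [hw₀, hw₁]
    · intro t hts
      have hn : Set.Icc t₀ t₁ ∈ nhds t := Icc_mem_nhds hts.1 hts.2
      have hts' := Set.Ioo_subset_Icc_self hts
      exact (((hm.differentiableOn (by simp)) t hts').hasDerivWithinAt.hasDerivAt hn).clm_apply
        (((hw.differentiableOn (by simp)) t hts').hasDerivWithinAt.hasDerivAt hn)
  rw [← sub_eq_zero, ← intervalIntegral.integral_sub (hint h1) (hint h2), ← h3]
  refine intervalIntegral.integral_congr fun t _ => ?_
  simp only [map_add, coad, sub_apply, ContinuousLinearMap.comp_apply]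
  ring

theorem isReducedCritical_of_eulerPoincare {l : Alg → ℝ} (hl : ContDiff ℝ ∞ l) {t₀ t₁ : ℝ}
    (ht : t₀ < t₁) {v : ℝ → Alg} (hv : ContDiffOn ℝ ∞ v (Set.Icc t₀ t₁))
    (h : EulerPoincare l t₀ t₁ v) : IsReducedCritical l t₀ t₁ v := by
  rintro f ⟨hf, hfv, w, hw, hw₀, hw₁, hδ⟩
  have h1 := hasDerivAt_reducedAction hl ht hf hfv hδ
  rw [integral_variation_eq hl ht hv hw hw₀ hw₁, intervalIntegral.integral_congr
    (g := fun _ => 0), intervalIntegral.integral_zero] at h1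
  · exact h1
  · intro t hts
    rw [Set.uIcc_of_le ht.le] at hts
    simp only [(h t hts).derivWithin (uniqueDiffOn_Icc ht t hts), sub_self,
      zero_apply]

/-- The fundamental lemma of the calculus of variations for the Euler–Poincaré equations. -/
theorem eulerPoincare_of_integral_eq_zero {l : Alg → ℝ} (hl : ContDiff ℝ ∞ l) {t₀ t₁ : ℝ}
    (ht : t₀ < t₁) {v : ℝ → Alg} (hv : ContDiffOn ℝ ∞ v (Set.Icc t₀ t₁))
    (h : ∀ w : ℝ → Alg, ContDiffOn ℝ ∞ w (Set.Icc t₀ t₁) → w t₀ = 0 → w t₁ = 0 →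
      ∫ t in t₀..t₁, fderiv ℝ l (v t) (derivWithin w (Set.Icc t₀ t₁) t + ad (v t) (w t)) = 0) :
    EulerPoincare l t₀ t₁ v := by
  have hm : ContDiffOn ℝ ∞ (fun s => fderiv ℝ l (v s)) (Set.Icc t₀ t₁) :=
    (hl.fderiv_right (m := ∞) (by simp)).comp_contDiffOn hv
  have hm' := contDiffOn_derivWithin_Icc ht hm
  suffices hzero : ∀ u : Alg, ∀ t ∈ Set.Icc t₀ t₁, (coad (v t) (fderiv ℝ l (v t)) -
      derivWithin (fun s => fderiv ℝ l (v s)) (Set.Icc t₀ t₁) t) u = 0 by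
    intro t hts
    have h1 : coad (v t) (fderiv ℝ l (v t)) =
        derivWithin (fun s => fderiv ℝ l (v s)) (Set.Icc t₀ t₁) t :=
      sub_eq_zero.1 (ContinuousLinearMap.ext fun u => hzero u t hts)
    rw [h1]
    exact ((hm.differentiableOn (by simp)) t hts).hasDerivWithinAt
  intro u
  set r : ℝ → ℝ := fun t => (coad (v t) (fderiv ℝ l (v t)) -
      derivWithin (fun s => fderiv ℝ l (v s)) (Set.Icc t₀ t₁) t) u with hr
  have hrs : ContDiffOn ℝ ∞ r (Set.Icc t₀ t₁) :=
    (hm.clm_apply (contDiffOn_ad hv contDiffOn_const)).sub (hm'.clm_apply contDiffOn_const)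
  -- Test curve `(t - t₀) (t₁ - t) r(t) u`: the residual itself, with a weight positive inside and
  -- zero at the endpoints. It turns the hypothesis into the vanishing of the integral of weight
  -- times `r²`, with no need for bump functions.
  have hbs : ContDiffOn ℝ ∞ (fun t => (t - t₀) * (t₁ - t) * r t) (Set.Icc t₀ t₁) :=
    ContDiffOn.mul (by fun_prop) hrs
  have hw : ContDiffOn ℝ ∞ (fun t => ((t - t₀) * (t₁ - t) * r t) • u) (Set.Icc t₀ t₁) :=
    hbs.smul contDiffOn_const
  have h1 := h _ hw (by simp) (by simp)
  rw [integral_variation_eq hl ht hv hw (by simp) (by simp)] at h1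
  have h2 : ∫ t in t₀..t₁, (t - t₀) * (t₁ - t) * r t * r t = 0 := by
    rw [← h1]
    refine intervalIntegral.integral_congr fun t _ => ?_
    simp only [map_smul, smul_eq_mul, hr]
  have hnn : ∀ t ∈ Set.Icc t₀ t₁, 0 ≤ (t - t₀) * (t₁ - t) * r t * r t := fun t hts => by
    rw [mul_assoc]
    exact mul_nonneg (mul_nonneg (sub_nonneg.2 hts.1) (sub_nonneg.2 hts.2)) (mul_self_nonneg _)
  have hinner : Set.EqOn r 0 (Set.Ioo t₀ t₁) := by
    intro t hts
    by_contra hne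
    refine (intervalIntegral.integral_pos ht (hbs.mul hrs).continuousOn
      (fun s hs => hnn s (Set.Ioc_subset_Icc_self hs))
      ⟨t, Set.Ioo_subset_Icc_self hts, ?_⟩).ne' h2
    rw [mul_assoc]
    exact mul_pos (mul_pos (sub_pos.2 hts.1) (sub_pos.2 hts.2)) (mul_self_pos.2 hne)
  -- The weight gives no information at the endpoints; continuity of `r` supplies it.
  exact hinner.of_subset_closure hrs.continuousOn continuousOn_const Set.Ioo_subset_Icc_self
    (closure_Ioo ht.ne).ge

theorem isReducedCritical_iff_eulerPoincare {l : Alg → ℝ} (hl : ContDiff ℝ ∞ l) {t₀ t₁ : ℝ}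
    (ht : t₀ < t₁) {v : ℝ → Alg} (hv : ContDiffOn ℝ ∞ v (Set.Icc t₀ t₁)) :
    IsReducedCritical l t₀ t₁ v ↔ EulerPoincare l t₀ t₁ v := by
  refine ⟨fun h => eulerPoincare_of_integral_eq_zero hl ht hv fun w hw hw₀ hw₁ => ?_,
    isReducedCritical_of_eulerPoincare hl ht hv⟩
  have hδ : ContDiffOn ℝ ∞ (fun t => derivWithin w (Set.Icc t₀ t₁) t + ad (v t) (w t))
      (Set.Icc t₀ t₁) := (contDiffOn_derivWithin_Icc ht hw).add (contDiffOn_ad hv hw)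
  have hsnd : Set.MapsTo Prod.snd (Set.univ ×ˢ Set.Icc t₀ t₁ : Set (ℝ × ℝ)) (Set.Icc t₀ t₁) :=
    fun p hp => hp.2
  -- The affine variation `v + ε δv` shows that every `w` vanishing at the endpoints is admissible.
  have hf : ContDiffOn ℝ ∞ (fun p : ℝ × ℝ =>
      v p.2 + p.1 • (derivWithin w (Set.Icc t₀ t₁) p.2 + ad (v p.2) (w p.2)))
      (Set.univ ×ˢ Set.Icc t₀ t₁) :=
    (hv.comp contDiffOn_snd hsnd).add (contDiffOn_fst.smul (hδ.comp contDiffOn_snd hsnd))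
  have hd : ∀ t ∈ Set.Icc t₀ t₁, HasDerivAt
      (fun ε : ℝ => v t + ε • (derivWithin w (Set.Icc t₀ t₁) t + ad (v t) (w t)))
      (derivWithin w (Set.Icc t₀ t₁) t + ad (v t) (w t)) 0 := fun t _ => by
    simpa using ((hasDerivAt_id (0 : ℝ)).smul_const
      (derivWithin w (Set.Icc t₀ t₁) t + ad (v t) (w t))).const_add (v t)
  have h0 : ∀ t ∈ Set.Icc t₀ t₁,
      v t + (0 : ℝ) • (derivWithin w (Set.Icc t₀ t₁) t + ad (v t) (w t)) = v t := fun t _ => by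
    rw [zero_smul, add_zero]
  exact (hasDerivAt_reducedAction hl ht
    (f := fun ε t => v t + ε • (derivWithin w (Set.Icc t₀ t₁) t + ad (v t) (w t))) hf h0 hd).unique
    (h _ ⟨hf, h0, w, hw, hw₀, hw₁, hd⟩)

/-! ### Reduction of smooth curves and variations in the configuration space -/

/-- The left trivialization `(q, q̇) ↦ q⁻¹ q̇` of the tangent bundle, extended to a bilinear map on
the ambient vector space. -/
noncomputable def trivialization : Amb →L[ℝ] Amb →L[ℝ] Alg :=
  LinearMap.toContinuousLinearMap
    (LinearMap.toContinuousLinearMap.toLinearMap.comp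
      (LinearMap.mk₂ ℝ (fun a w : Amb => ((vee ((Matrix.of a.1)ᵀ * Matrix.of w.1),
          fun k => ((starRingEnd ℂ) (a.2 k) * w.2 k).im) : Alg))
        (fun a b w => by
          refine Prod.ext (funext fun k => ?_) (funext fun k => ?_)
          · fin_cases k <;> simp [vee, Matrix.mul_apply, Fin.sum_univ_three] <;> ring
          · simp; ring)
        (fun c a w => by
          refine Prod.ext (funext fun k => ?_) (funext fun k => ?_)
          · fin_cases k <;> simp [vee, Matrix.mul_apply, Fin.sum_univ_three] <;> ring
          · simp; ring)
        (fun a w u => by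
          refine Prod.ext (funext fun k => ?_) (funext fun k => ?_)
          · fin_cases k <;> simp [vee, Matrix.mul_apply, Fin.sum_univ_three] <;> ring
          · simp; ring)
        (fun c a w => by
          refine Prod.ext (funext fun k => ?_) (funext fun k => ?_)
          · fin_cases k <;> simp [vee, Matrix.mul_apply, Fin.sum_univ_three] <;> ring
          · simp; ring)))

theorem trivialization_apply (a w : Amb) :
    trivialization a w = (vee ((Matrix.of a.1)ᵀ * Matrix.of w.1),
      fun k => ((starRingEnd ℂ) (a.2 k) * w.2 k).im) := rfl

/-- On `Q` the inverse is the transpose, respectively the complex conjugate, so `q⁻¹ q̇` is the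
restriction of a bilinear map and can be differentiated by the product rule in the ambient space. -/
theorem reduce_eq_trivialization (x : TQ) : reduce x = trivialization (emb x.1.1) x.1.2 := by
  refine Prod.ext rfl (funext fun k => ?_)
  change ((((x.1.1.2 k)⁻¹ : Circle) : ℂ) * x.1.2.2 k).im = _
  rw [Circle.coe_inv_eq_conj]
  rfl

theorem reducedCurve_eq (q : ℝ → Q) (t₀ t₁ t : ℝ) :
    reducedCurve q t₀ t₁ t =
      trivialization (emb (q t)) (derivWithin (fun s => emb (q s)) (Set.Icc t₀ t₁) t) :=
  reduce_eq_trivialization _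

/-- Needed because a variation at `ε = 0` agrees with `q` only on `[t₀, t₁]`; the velocity within
the interval does not see the rest. -/
theorem reducedCurve_congr {q p : ℝ → Q} {t₀ t₁ : ℝ} (h : Set.EqOn q p (Set.Icc t₀ t₁)) :
    Set.EqOn (reducedCurve q t₀ t₁) (reducedCurve p t₀ t₁) (Set.Icc t₀ t₁) := by
  intro t ht
  rw [reducedCurve_eq, reducedCurve_eq, h ht,
    derivWithin_congr (fun s hs => by rw [h hs]) (by rw [h ht])]

theorem contDiffOn_reducedCurve {q : ℝ → Q} {t₀ t₁ : ℝ} (ht : t₀ < t₁)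
    (hq : SmoothMapOn q (Set.Icc t₀ t₁)) :
    ContDiffOn ℝ ∞ (reducedCurve q t₀ t₁) (Set.Icc t₀ t₁) :=
  ((trivialization.contDiff.comp_contDiffOn hq).clm_apply (contDiffOn_derivWithin_Icc ht hq)).congr
    fun t _ => reducedCurve_eq q t₀ t₁ t

theorem isTangent_iff_exists (q : Q) (w : Amb) :
    IsTangent q w ↔ ∃ v : Alg, (Matrix.of w.1 = (q.1 : Mat3) * hat v.1) ∧
      ∀ k, w.2 k = q.2 k * (Complex.I * v.2 k) := by
  constructor
  · intro h
    have hx := congrArg Subtype.val (smul_tangentAtOne_reduce ⟨(q, w), h⟩)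
    exact ⟨reduce ⟨(q, w), h⟩, (congrArg (fun y : Q × Amb => y.2.1) hx).symm,
      fun k => (congrArg (fun y : Q × Amb => y.2.2 k) hx).symm⟩
  · rintro ⟨v, h1, h2⟩
    have h3 : w = (q • tangentAtOne v : TQ).1.2 :=
      Prod.ext h1 (funext h2)
    have h4 := (q • tangentAtOne v : TQ).2
    rw [← h3] at h4
    convert h4
    exact (mul_one q).symm

theorem trivialization_emb (q : Q) (v : Alg) (w : Amb)
    (h₁ : Matrix.of w.1 = (q.1 : Mat3) * hat v.1) (h₂ : ∀ k, w.2 k = q.2 k * (Complex.I * v.2 k)) :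
    trivialization (emb q) w = v := by
  rw [trivialization_apply]
  refine Prod.ext ?_ (funext fun k => ?_)
  · change vee ((q.1 : Mat3)ᵀ * Matrix.of w.1) = v.1
    rw [h₁, ← Matrix.mul_assoc, transpose_mul_self_SO3, Matrix.one_mul, vee_hat]
  · change ((starRingEnd ℂ) (q.2 k : ℂ) * w.2 k).im = v.2 k
    rw [h₂ k, ← Circle.coe_inv_eq_conj, ← mul_assoc, ← Circle.coe_mul, inv_mul_cancel]
    simp

/-- The Maurer–Cartan structure equation. -/
theorem trivialization_sub_trivialization (q : Q) (a b : Amb) (ha : IsTangent q a)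
    (hb : IsTangent q b) :
    trivialization a b - trivialization b a =
      ad (trivialization (emb q) b) (trivialization (emb q) a) := by
  obtain ⟨u, ha₁, ha₂⟩ := (isTangent_iff_exists q a).1 ha
  obtain ⟨v, hb₁, hb₂⟩ := (isTangent_iff_exists q b).1 hb
  rw [trivialization_emb q u a ha₁ ha₂, trivialization_emb q v b hb₁ hb₂, ad_apply,
    trivialization_apply, trivialization_apply]
  -- The rotation cancels and skew-symmetry gives the sign, so antisymmetrizing leaves the
  -- commutator of the two `hat` matrices, which is `hat` of the vector product.
  have key : ∀ x y : R3, ((q.1 : Mat3) * hat x)ᵀ * ((q.1 : Mat3) * hat y) = -(hat x * hat y) := by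
    intro x y
    rw [Matrix.transpose_mul, Matrix.mul_assoc, ← Matrix.mul_assoc _ (q.1 : Mat3),
      transpose_mul_self_SO3, Matrix.one_mul, hat_transpose, Matrix.neg_mul]
  refine Prod.ext ?_ (funext fun k => ?_)
  · change vee ((Matrix.of a.1)ᵀ * Matrix.of b.1) - vee ((Matrix.of b.1)ᵀ * Matrix.of a.1) =
      v.1 ⨯₃ u.1
    rw [ha₁, hb₁, key, key, ← vee_hat (v.1 ⨯₃ u.1), hat_cross]
    ext k
    fin_cases k <;> simp [vee] <;> ring
  · change ((starRingEnd ℂ) (a.2 k) * b.2 k).im - ((starRingEnd ℂ) (b.2 k) * a.2 k).im = 0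
    rw [ha₂ k, hb₂ k]
    simp
    ring

/-! ### How a variation in the group acts on the reduced curve. -/

section Variation

variable {t₀ t₁ : ℝ} {f : ℝ → ℝ → Q}

theorem contDiffOn_fderivWithin_emb (ht : t₀ < t₁)
    (hf : SmoothMapOn (fun p : ℝ × ℝ => f p.1 p.2) (Set.univ ×ˢ Set.Icc t₀ t₁)) :
    ContDiffOn ℝ ∞ (fun p : ℝ × ℝ => fderivWithin ℝ (fun p : ℝ × ℝ => emb (f p.1 p.2))
      (Set.univ ×ˢ Set.Icc t₀ t₁) (p.1, p.2)) (Set.univ ×ˢ Set.Icc t₀ t₁) :=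
  ContDiffOn.fderivWithin hf (uniqueDiffOn_univ_prod_Icc ht) (by simp)

theorem reducedCurve_variation_eq (ht : t₀ < t₁)
    (hf : SmoothMapOn (fun p : ℝ × ℝ => f p.1 p.2) (Set.univ ×ˢ Set.Icc t₀ t₁)) (ε : ℝ) {t : ℝ}
    (hts : t ∈ Set.Icc t₀ t₁) :
    reducedCurve (f ε) t₀ t₁ t = trivialization (emb (f ε t))
      (fderivWithin ℝ (fun p : ℝ × ℝ => emb (f p.1 p.2)) (Set.univ ×ˢ Set.Icc t₀ t₁) (ε, t)
        (0, 1)) := by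
  rw [reducedCurve_eq, (hasDerivWithinAt_snd_of_contDiffOn (g := fun ε t => emb (f ε t)) hf hts
    ε).derivWithin (uniqueDiffOn_Icc ht t hts)]

theorem contDiffOn_reducedCurve_variation (ht : t₀ < t₁)
    (hf : SmoothMapOn (fun p : ℝ × ℝ => f p.1 p.2) (Set.univ ×ˢ Set.Icc t₀ t₁)) :
    ContDiffOn ℝ ∞ (fun p : ℝ × ℝ => reducedCurve (f p.1) t₀ t₁ p.2)
      (Set.univ ×ˢ Set.Icc t₀ t₁) :=
  ((trivialization.contDiff.comp_contDiffOn hf).clm_apply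
    ((contDiffOn_fderivWithin_emb ht hf).clm_apply contDiffOn_const)).congr
    fun p hp => reducedCurve_variation_eq ht hf p.1 hp.2

/-- The infinitesimal variation of the reduced curve. -/
theorem hasDerivAt_reducedCurve_variation (ht : t₀ < t₁)
    (hf : SmoothMapOn (fun p : ℝ × ℝ => f p.1 p.2) (Set.univ ×ˢ Set.Icc t₀ t₁)) {d : ℝ → Amb}
    (hd : ∀ t ∈ Set.Icc t₀ t₁, HasDerivAt (fun ε => emb (f ε t)) (d t) 0) {w : ℝ → Alg}
    (hw : ∀ t ∈ Set.Icc t₀ t₁, w t = trivialization (emb (f 0 t)) (d t)) {t : ℝ}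
    (hts : t ∈ Set.Icc t₀ t₁) :
    HasDerivAt (fun ε => reducedCurve (f ε) t₀ t₁ t)
      (derivWithin w (Set.Icc t₀ t₁) t + ad (reducedCurve (f 0) t₀ t₁ t) (w t)) 0 := by
  set S : Set (ℝ × ℝ) := Set.univ ×ˢ Set.Icc t₀ t₁ with hS
  set D : ℝ → ℝ → (ℝ × ℝ →L[ℝ] Amb) := fun ε t =>
    fderivWithin ℝ (fun p : ℝ × ℝ => emb (f p.1 p.2)) S (ε, t) with hD
  have hDs : ContDiffOn ℝ ∞ (fun p : ℝ × ℝ => D p.1 p.2) S := contDiffOn_fderivWithin_emb ht hf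
  set H := fderivWithin ℝ (fun p : ℝ × ℝ => D p.1 p.2) S (0, t) with hH
  -- Mixed partials commute even on the boundary of the closed strip, since each of its points is in
  -- the closure of the interior.
  have hsymm : H (1, 0) (0, 1) = H (0, 1) (1, 0) := by
    refine ContDiffWithinAt.isSymmSndFDerivWithinAt (hf (0, t) ⟨trivial, hts⟩)
      (by rw [minSmoothness_of_isRCLikeNormedField]; exact WithTop.coe_le_coe.2 le_top)
      (uniqueDiffOn_univ_prod_Icc ht) ?_ ⟨trivial, hts⟩ (1, 0) (0, 1)
    rw [interior_prod_eq, interior_univ, interior_Icc, closure_prod_eq, closure_univ,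
      closure_Ioo ht.ne]
    exact ⟨trivial, hts⟩
  have hε := fun s (hs : s ∈ Set.Icc t₀ t₁) =>
    hasDerivAt_fst_of_contDiffOn (g := fun ε t => emb (f ε t)) hf hs 0
  have htt := hasDerivWithinAt_snd_of_contDiffOn (g := fun ε t => emb (f ε t)) hf hts 0
  have hDε := (hasDerivAt_fst_of_contDiffOn (g := D) hDs hts 0).clm_apply
    (hasDerivAt_const (0 : ℝ) ((0, 1) : ℝ × ℝ))
  have hDt := (hasDerivWithinAt_snd_of_contDiffOn (g := D) hDs hts 0).clm_apply
    (hasDerivWithinAt_const t (Set.Icc t₀ t₁) ((1, 0) : ℝ × ℝ))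
  have hv := (trivialization.hasFDerivAt.comp_hasDerivAt (0 : ℝ) (hε t hts)).clm_apply hDε
  have hw' := (trivialization.hasFDerivAt.comp_hasDerivWithinAt t htt).clm_apply hDt
  have hwD : ∀ s ∈ Set.Icc t₀ t₁, w s = trivialization (emb (f 0 s)) (D 0 s (1, 0)) :=
    fun s hs => by rw [hw s hs, (hd s hs).unique (hε s hs)]
  have hwd := (hw'.congr hwD (hwD t hts)).derivWithin (uniqueDiffOn_Icc ht t hts)
  have htanε : IsTangent (f 0 t) (D 0 t (1, 0)) :=
    isTangent_of_hasDerivWithinAt (fun ε => f ε t) Set.univ 0 _ uniqueDiffWithinAt_univ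
      (hε t hts).hasDerivWithinAt
  have htant : IsTangent (f 0 t) (D 0 t (0, 1)) :=
    isTangent_of_hasDerivWithinAt (f 0) _ t _ (uniqueDiffOn_Icc ht t hts) htt
  have hmc := trivialization_sub_trivialization (f 0 t) _ _ htanε htant
  have hfun : (fun ε => reducedCurve (f ε) t₀ t₁ t) =
      fun ε => trivialization (emb (f ε t)) (D ε t (0, 1)) :=
    funext fun ε => reducedCurve_variation_eq ht hf ε hts
  rw [hfun, hwd, hwD t hts, reducedCurve_variation_eq ht hf 0 hts, ← hmc]
  convert! hv using 1
  -- Both sides written out by the product rule: the second-order terms agree by `hsymm`, and the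
  -- first-order ones cancel through the bracket. The terms `D 0 t 0` come from differentiating the
  -- constant directions.
  change trivialization (D 0 t (0, 1)) (D 0 t (1, 0)) +
      trivialization (emb (f 0 t)) (H (0, 1) (1, 0) + D 0 t 0) +
      (trivialization (D 0 t (1, 0)) (D 0 t (0, 1)) -
        trivialization (D 0 t (0, 1)) (D 0 t (1, 0))) =
    trivialization (D 0 t (1, 0)) (D 0 t (0, 1)) +
      trivialization (emb (f 0 t)) (H (1, 0) (0, 1) + D 0 t 0)
  rw [hsymm]
  abel

end Variation

/-- The generator is `w = q⁻¹ δq`; it vanishes at the endpoints because the variation is fixed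
there. -/
theorem isReducedVariation_reducedCurve {t₀ t₁ : ℝ} (ht : t₀ < t₁) {q : ℝ → Q} {f : ℝ → ℝ → Q}
    (hf : IsVariation q t₀ t₁ f) :
    IsReducedVariation (reducedCurve q t₀ t₁) t₀ t₁ fun ε => reducedCurve (f ε) t₀ t₁ := by
  obtain ⟨hfs, hf0, hfe⟩ := hf
  have hcongr := reducedCurve_congr hf0
  set d : ℝ → Amb := fun t => fderivWithin ℝ (fun p : ℝ × ℝ => emb (f p.1 p.2))
    (Set.univ ×ˢ Set.Icc t₀ t₁) (0, t) (1, 0) with hd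
  have hdd : ∀ t ∈ Set.Icc t₀ t₁, HasDerivAt (fun ε => emb (f ε t)) (d t) 0 := fun t hts =>
    hasDerivAt_fst_of_contDiffOn (g := fun ε t => emb (f ε t)) hfs hts 0
  have hslice : ContDiffOn ℝ ∞ (fun t : ℝ => ((0 : ℝ), t)) (Set.Icc t₀ t₁) := by fun_prop
  have hmaps : Set.MapsTo (fun t : ℝ => ((0 : ℝ), t)) (Set.Icc t₀ t₁)
      (Set.univ ×ˢ Set.Icc t₀ t₁) := fun t hts => ⟨trivial, hts⟩
  have hzero : ∀ t ∈ Set.Icc t₀ t₁, (∀ ε, f ε t = q t) → d t = 0 := fun t hts h => by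
    have h1 := hdd t hts
    simp only [h] at h1
    exact h1.unique (hasDerivAt_const _ _)
  refine ⟨contDiffOn_reducedCurve_variation ht hfs, hcongr,
    fun t => trivialization (emb (f 0 t)) (d t), ?_, ?_, ?_, fun t hts => ?_⟩
  · exact (trivialization.contDiff.comp_contDiffOn (ContDiffOn.comp hfs hslice hmaps)).clm_apply
      ((ContDiffOn.comp (contDiffOn_fderivWithin_emb ht hfs) hslice hmaps).clm_apply
        contDiffOn_const)
  · simp only [hzero t₀ (Set.left_mem_Icc.2 ht.le) fun ε => (hfe ε).1, map_zero]
  · simp only [hzero t₁ (Set.right_mem_Icc.2 ht.le) fun ε => (hfe ε).2, map_zero]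
  · rw [← hcongr hts]
    exact hasDerivAt_reducedCurve_variation ht hfs hdd (fun _ _ => rfl) hts

theorem isCritical_of_isReducedCritical {I K : Mat3} {t₀ t₁ : ℝ} (ht : t₀ < t₁) {q : ℝ → Q}
    (h : IsReducedCritical (reducedLagrangian I K) t₀ t₁ (reducedCurve q t₀ t₁)) :
    IsCritical (lagrangian I K) t₀ t₁ q :=
  fun _ hf => h _ (isReducedVariation_reducedCurve ht hf)

/-! ### Variations with prescribed infinitesimal generator -/

/-- The Cayley transform of `hat a`, as a matrix. -/
noncomputable def cayleyMatrix (a : R3) : Mat3 :=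
  1 + (1 + (a ⬝ᵥ a) / 4)⁻¹ • (hat a + (1 / 2 : ℝ) • (hat a * hat a))

theorem one_add_dotProduct_self_pos (a : R3) : 0 < 1 + (a ⬝ᵥ a) / 4 := by
  have h : 0 ≤ a ⬝ᵥ a := Finset.sum_nonneg fun i _ => mul_self_nonneg (a i)
  positivity

/-- As `â³ = -|a|² â`, the matrix is `(1 - â/2)⁻¹ (1 + â/2)`. In this closed form membership is a
rational identity in the entries of `a`, and smoothness is clear since the denominator never
vanishes; to first order it agrees with the exponential. -/
theorem cayleyMatrix_mem (a : R3) :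
    cayleyMatrix a ∈ Matrix.specialOrthogonalGroup (Fin 3) ℝ := by
  have hpos := (one_add_dotProduct_self_pos a).ne'
  rw [mem_SO3_iff]
  simp only [dotProduct, Fin.sum_univ_three] at hpos
  constructor
  · ext i j
    fin_cases i <;> fin_cases j <;>
      simp [cayleyMatrix, hat, dotProduct, Fin.sum_univ_three, Matrix.mul_apply] <;>
      field_simp <;> ring
  · simp [cayleyMatrix, hat, dotProduct, Fin.sum_univ_three, Matrix.det_fin_three]
    field_simp
    ring

/-- The Cayley transform of the Lie algebra into the rotation group. -/
noncomputable def cayley (a : R3) : SO3 := ⟨cayleyMatrix a, cayleyMatrix_mem a⟩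

theorem cayley_zero : cayley 0 = 1 := by
  apply Subtype.ext
  have h : hat 0 = 0 := by ext i j; fin_cases i <;> fin_cases j <;> simp [hat]
  change cayleyMatrix 0 = 1
  simp [cayleyMatrix, h]

theorem contDiff_hat_apply (i j : Fin 3) : ContDiff ℝ ∞ fun a : R3 => hat a i j := by
  fin_cases i <;> fin_cases j <;> simp [hat] <;> fun_prop

theorem contDiff_cayleyMatrix_apply (i j : Fin 3) :
    ContDiff ℝ ∞ fun a : R3 => cayleyMatrix a i j := by
  have h1 : ContDiff ℝ ∞ fun a : R3 => (1 + (a ⬝ᵥ a) / 4)⁻¹ :=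
    ContDiff.inv (contDiff_const.add ((contDiff_dotProduct contDiff_id contDiff_id).div_const 4))
      fun a => (one_add_dotProduct_self_pos a).ne'
  have h2 : ContDiff ℝ ∞ fun a : R3 => (hat a * hat a) i j := by
    simp only [Matrix.mul_apply]
    exact ContDiff.sum fun k _ => (contDiff_hat_apply i k).mul (contDiff_hat_apply k j)
  exact contDiff_const.add (h1.mul ((contDiff_hat_apply i j).add (contDiff_const.mul h2)))

theorem hat_smul (c : ℝ) (a : R3) : hat (c • a) = c • hat a := by
  ext i j
  fin_cases i <;> fin_cases j <;> simp [hat]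

theorem hasDerivAt_cayleyMatrix (a : R3) (i j : Fin 3) :
    HasDerivAt (fun ε : ℝ => cayleyMatrix (ε • a) i j) (hat a i j) 0 := by
  -- The entry is a constant plus `ε g(ε)`, whose derivative at `0` is `g(0)`; only
  -- differentiability of `g` is needed, not its derivative.
  set g : ℝ → ℝ := fun ε => (1 + ((ε • a) ⬝ᵥ (ε • a)) / 4)⁻¹ *
    (hat a i j + 1 / 2 * (ε * (hat a * hat a) i j)) with hg
  have hgd : DifferentiableAt ℝ g 0 := by
    refine DifferentiableAt.mul (DifferentiableAt.inv ?_ (one_add_dotProduct_self_pos _).ne')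
      (by fun_prop)
    simp only [smul_dotProduct, dotProduct_smul, smul_eq_mul]
    fun_prop
  have h := ((hasDerivAt_id (0 : ℝ)).mul hgd.hasDerivAt).const_add ((1 : Mat3) i j)
  convert! h using 1
  · funext ε
    simp only [cayleyMatrix, hat_smul, hg, Matrix.add_apply, Matrix.smul_apply, smul_eq_mul,
      Matrix.smul_mul, Matrix.mul_smul, Pi.mul_apply, id_eq]
    ring
  · simp [hg]

/-- A variation of the curve `q` generated by the curve `w` in the Lie algebra. -/
noncomputable def generatedVariation (q : ℝ → Q) (w : ℝ → Alg) (ε t : ℝ) : Q :=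
  q t * (cayley (ε • (w t).1), fun k => Circle.exp (ε * (w t).2 k))

section GeneratedVariation

variable {t₀ t₁ : ℝ} {q : ℝ → Q} {w : ℝ → Alg}

theorem generatedVariation_of_smul_eq_zero {ε t : ℝ} (h : ε • w t = 0) :
    generatedVariation q w ε t = q t := by
  have h1 : ε • (w t).1 = 0 := congrArg Prod.fst h
  have h2 : ∀ k, ε * (w t).2 k = 0 := fun k => congrFun (congrArg Prod.snd h) k
  rw [generatedVariation, h1, cayley_zero]
  simp only [h2, Circle.exp_zero]
  exact mul_one _

theorem emb_generatedVariation (ε t : ℝ) :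
    emb (generatedVariation q w ε t) =
      (fun i j => ∑ k, ((q t).1 : Mat3) i k * cayleyMatrix (ε • (w t).1) k j,
        fun k => ((q t).2 k : ℂ) * Complex.exp ((ε * (w t).2 k : ℝ) * Complex.I)) := by
  refine Prod.ext rfl (funext fun k => ?_)
  change (((q t).2 k * Circle.exp (ε * (w t).2 k) : Circle) : ℂ) = _
  rw [Circle.coe_mul, Circle.coe_exp]

theorem isVariation_generatedVariation (hq : SmoothMapOn q (Set.Icc t₀ t₁))
    (hw : ContDiffOn ℝ ∞ w (Set.Icc t₀ t₁)) (hw₀ : w t₀ = 0) (hw₁ : w t₁ = 0) :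
    IsVariation q t₀ t₁ (generatedVariation q w) := by
  refine ⟨?_, fun t _ => generatedVariation_of_smul_eq_zero (zero_smul _ _), fun ε =>
    ⟨generatedVariation_of_smul_eq_zero (by rw [hw₀, smul_zero]),
      generatedVariation_of_smul_eq_zero (by rw [hw₁, smul_zero])⟩⟩
  have hsnd : Set.MapsTo Prod.snd (Set.univ ×ˢ Set.Icc t₀ t₁ : Set (ℝ × ℝ)) (Set.Icc t₀ t₁) :=
    fun p hp => hp.2
  have hq' : ContDiffOn ℝ ∞ (fun p : ℝ × ℝ => emb (q p.2)) (Set.univ ×ˢ Set.Icc t₀ t₁) :=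
    ContDiffOn.comp hq contDiffOn_snd hsnd
  have hw' : ContDiffOn ℝ ∞ (fun p : ℝ × ℝ => p.1 • w p.2) (Set.univ ×ˢ Set.Icc t₀ t₁) :=
    contDiffOn_fst.smul (hw.comp contDiffOn_snd hsnd)
  simp only [SmoothMapOn, emb_generatedVariation]
  refine ContDiffOn.prodMk (contDiffOn_pi.2 fun i => contDiffOn_pi.2 fun j =>
    ContDiffOn.sum fun k _ => ContDiffOn.mul ?_ ?_) (contDiffOn_pi.2 fun k => ContDiffOn.mul ?_ ?_)
  · exact contDiffOn_pi.1 (contDiffOn_pi.1 hq'.fst i) k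
  · exact (contDiff_cayleyMatrix_apply k j).comp_contDiffOn hw'.fst
  · exact contDiffOn_pi.1 hq'.snd k
  · exact ((Complex.ofRealCLM.contDiff.comp_contDiffOn (contDiffOn_pi.1 hw'.snd k)).mul
      contDiffOn_const).cexp

/-- The derivative is `q` times `w`, so the left trivialization of `δq` is exactly the prescribed
`w`. -/
theorem hasDerivAt_generatedVariation (q : ℝ → Q) (w : ℝ → Alg) (t : ℝ) :
    HasDerivAt (fun ε => emb (generatedVariation q w ε t))
      (fun i j => (((q t).1 : Mat3) * hat (w t).1) i j,
        fun k => (q t).2 k * (Complex.I * (w t).2 k)) 0 := by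
  simp only [emb_generatedVariation]
  refine HasDerivAt.prodMk (hasDerivAt_pi.2 fun i => hasDerivAt_pi.2 fun j =>
    HasDerivAt.fun_sum fun k _ => (hasDerivAt_cayleyMatrix _ _ _).const_mul _)
    (hasDerivAt_pi.2 fun k => HasDerivAt.const_mul _ ?_)
  have h1 : HasDerivAt (fun ε : ℝ => ((ε * (w t).2 k : ℝ) : ℂ) * Complex.I)
      (((w t).2 k : ℂ) * Complex.I) 0 := by
    refine HasDerivAt.mul_const ?_ _
    simpa using ((hasDerivAt_id (0 : ℝ)).mul_const ((w t).2 k)).ofReal_comp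
  simpa [mul_comm] using h1.cexp

end GeneratedVariation

/-- A reduced variation need not be lifted to the group: the first variation depends only on `w`.
The generated variations make it vanish for every `w`, which yields the Euler–Poincaré equations and
hence reduced criticality. -/
theorem isReducedCritical_of_isCritical {I K : Mat3} {t₀ t₁ : ℝ} (ht : t₀ < t₁) {q : ℝ → Q}
    (hq : SmoothMapOn q (Set.Icc t₀ t₁)) (h : IsCritical (lagrangian I K) t₀ t₁ q) :
    IsReducedCritical (reducedLagrangian I K) t₀ t₁ (reducedCurve q t₀ t₁) := by
  have hl := contDiff_reducedLagrangian I K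
  have hv := contDiffOn_reducedCurve ht hq
  rw [isReducedCritical_iff_eulerPoincare hl ht hv]
  refine eulerPoincare_of_integral_eq_zero hl ht hv fun w hw hw₀ hw₁ => ?_
  have hf := isVariation_generatedVariation hq hw hw₀ hw₁
  have hcongr := reducedCurve_congr hf.2.1
  have hδ : ∀ t ∈ Set.Icc t₀ t₁, HasDerivAt
      (fun ε => reducedCurve (generatedVariation q w ε) t₀ t₁ t)
      (derivWithin w (Set.Icc t₀ t₁) t + ad (reducedCurve q t₀ t₁ t) (w t)) 0 := fun t hts => by
    rw [← hcongr hts]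
    refine hasDerivAt_reducedCurve_variation ht hf.1
      (fun s _ => hasDerivAt_generatedVariation q w s) (fun s hs => ?_) hts
    rw [hf.2.1 s hs]
    exact (trivialization_emb (q s) (w s) _ rfl fun _ => rfl).symm
  exact (hasDerivAt_reducedAction hl ht
    (f := fun ε => reducedCurve (generatedVariation q w ε) t₀ t₁) (contDiffOn_reducedCurve_variation ht hf.1)
    hcongr hδ).unique (h _ hf)

end RotorBody

/-! ### The main theorem. -/

theorem mainTheorem1 (I K : RotorBody.Mat3) (hI : I.IsSymm) (hK : K.IsSymm) :
    -- the lifted action is free and proper, and the Lagrangian is invariant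
    (∀ (g : RotorBody.Q) (x : RotorBody.TQ), g • x = x → g = 1) ∧
    ProperSMul RotorBody.Q RotorBody.TQ ∧
    (∀ (g : RotorBody.Q) (x : RotorBody.TQ),
      RotorBody.lagrangian I K (g • x) = RotorBody.lagrangian I K x) ∧
    -- the quotient is `so(3) ⊕ ℝ³`, and the Lagrangian drops to the reduced Lagrangian
    (∃ Φ : MulAction.orbitRel.Quotient RotorBody.Q RotorBody.TQ ≃ₜ RotorBody.Alg,
      ∀ x : RotorBody.TQ,
        Φ (Quotient.mk (MulAction.orbitRel RotorBody.Q RotorBody.TQ) x) = RotorBody.reduce x ∧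
        RotorBody.reducedLagrangian I K
            (Φ (Quotient.mk (MulAction.orbitRel RotorBody.Q RotorBody.TQ) x)) =
          RotorBody.lagrangian I K x) ∧
    -- the reduced equations, for an arbitrary curve in `so(3) ⊕ ℝ³`
    (∀ (t₀ t₁ : ℝ), t₀ < t₁ → ∀ v : ℝ → RotorBody.Alg, ContDiffOn ℝ ∞ v (Set.Icc t₀ t₁) →
      (RotorBody.IsReducedCritical (RotorBody.reducedLagrangian I K) t₀ t₁ v ↔
        RotorBody.EulerPoincare (RotorBody.reducedLagrangian I K) t₀ t₁ v) ∧
      (RotorBody.EulerPoincare (RotorBody.reducedLagrangian I K) t₀ t₁ v ↔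
        RotorBody.BodyEquation I K t₀ t₁ v ∧ RotorBody.RotorEquation K t₀ t₁ v)) ∧
    -- the motions of the system, for an arbitrary curve in the configuration space
    (∀ (t₀ t₁ : ℝ), t₀ < t₁ → ∀ q : ℝ → RotorBody.Q,
      RotorBody.SmoothMapOn q (Set.Icc t₀ t₁) →
      ContDiffOn ℝ ∞ (RotorBody.reducedCurve q t₀ t₁) (Set.Icc t₀ t₁) ∧
      (RotorBody.IsCritical (RotorBody.lagrangian I K) t₀ t₁ q ↔
        RotorBody.IsReducedCritical (RotorBody.reducedLagrangian I K) t₀ t₁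
          (RotorBody.reducedCurve q t₀ t₁)) ∧
      (RotorBody.IsCritical (RotorBody.lagrangian I K) t₀ t₁ q ↔
        RotorBody.BodyEquation I K t₀ t₁ (RotorBody.reducedCurve q t₀ t₁) ∧
          RotorBody.RotorEquation K t₀ t₁ (RotorBody.reducedCurve q t₀ t₁)) ∧
      -- the second equation is the conservation of the momentum of the rotors
      (RotorBody.RotorEquation K t₀ t₁ (RotorBody.reducedCurve q t₀ t₁) ↔
        ∀ a : RotorBody.R3, ∀ t ∈ Set.Icc t₀ t₁,
          RotorBody.rotorMomentum (RotorBody.lagrangian I K)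
              (RotorBody.tangentLift q (Set.Icc t₀ t₁) t) a =
            RotorBody.rotorMomentum (RotorBody.lagrangian I K)
              (RotorBody.tangentLift q (Set.Icc t₀ t₁) t₀) a)) ∧
    -- the momentum of the rotors is `K (Ω + Ω_r)`
    (∀ (x : RotorBody.TQ) (a : RotorBody.R3),
      RotorBody.rotorMomentum (RotorBody.lagrangian I K) x a =
        (K *ᵥ (RotorBody.bodyVel x + RotorBody.rotorVel x)) ⬝ᵥ a) := by
  have hl := RotorBody.contDiff_reducedLagrangian I K
  refine ⟨RotorBody.eq_one_of_smul_eq, inferInstance, fun g x => ?_,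
    ⟨RotorBody.quotientHomeomorph, fun x => ⟨rfl, rfl⟩⟩, fun t₀ t₁ ht v hv => ?_,
    fun t₀ t₁ ht q hq => ?_, RotorBody.rotorMomentum_lagrangian hI hK⟩
  · rw [RotorBody.lagrangian_eq, RotorBody.reduce_smul, RotorBody.lagrangian_eq]
  · exact ⟨RotorBody.isReducedCritical_iff_eulerPoincare hl ht hv,
      RotorBody.eulerPoincare_iff hI hK ht (hv.differentiableOn (by simp))⟩
  · have hv := RotorBody.contDiffOn_reducedCurve ht hq
    have hvd := hv.differentiableOn (by simp)
    have hcrit : RotorBody.IsCritical (RotorBody.lagrangian I K) t₀ t₁ q ↔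
        RotorBody.IsReducedCritical (RotorBody.reducedLagrangian I K) t₀ t₁
          (RotorBody.reducedCurve q t₀ t₁) :=
      ⟨RotorBody.isReducedCritical_of_isCritical ht hq,
        RotorBody.isCritical_of_isReducedCritical ht⟩
    refine ⟨hv, hcrit, ?_, ?_⟩
    · rw [hcrit, RotorBody.isReducedCritical_iff_eulerPoincare hl ht hv,
        RotorBody.eulerPoincare_iff hI hK ht hvd]
    · rw [RotorBody.rotorEquation_iff_const ht hvd]
      simp only [RotorBody.rotorMomentum_lagrangian hI hK]
      -- A vector of `ℝ³` is determined by its scalar products, so constancy of the momentum for all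
      -- `a` is constancy of `K (Ω + Ω_r)`.
      exact ⟨fun h a t hts => congrArg (· ⬝ᵥ a) (h t hts),
        fun h t hts => dotProduct_eq _ _ fun a => h a t hts⟩
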